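/- Let $\Omega\subset\mathbb R^2\cong\mathbb C$ be a domain, $1<p<\infty$, $p\ne 2$, and let $u=(u^1,u^2)\in C^2(\Omega,\mathbb R^2)$ be a $p$-harmonic map, that is, a weak solution of $\operatorname{div}(|Du|^{p-2}\nabla u^i)=0$, $i=1,2$, where $|Du|^2=|\nabla u^1|^2+|\nabla u^2|^2$. Let $f=\frac12(u^1_x-iu^1_y)$ and $g=\frac12(u^2_x-iu^2_y)$ be the complex gradients, let $H(u^i)$ denote the Hessian matrix, and let $$k_{v}=-\frac{v_y^2v_{xx}-2v_xv_yv_{xy}+v_x^2v_{yy}}{|\nabla v|^3}=-\operatorname{div}\Big(\frac{\nabla v}{|\nabla v|}\Big)$$ be the curvature function of the level curves of $v$, defined where $\nabla v\neq0$. A map $F$ is called quasiregular in an open set $U$ if it is continuous, belongs to $W^{1,2}_{loc}(U)$, and satisfies $|F_{\bar z}|\le k|F_z|$ a.e. in $U$ for some constant $k<1$. Let $C>0$, and let $B=B(z_0,R)\subset\Omega$, $R>0$, be an open ball. Suppose that one of the following holds: (1) $\|H(u^1)\|,\|H(u^2)\|\in L^2(B)$ (Euclidean norms) and $|f|>C$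 in $B$; (2) $f_z,g_z\in L^2(B)$ and $|f|>C$ in $B$; (3) $\overline B\subset\Omega$, $f$ and $g$ are quasiregular in $B$, and $|f|>C$ in $B$; (4) $\overline B\subset\Omega$, $f$ and $g$ are quasiregular in $B$, and $|f(z)|>C|z-z_0|^{\alpha}$ for all $z\in B\setminus\{z_0\}$, with some $\alpha<1$. Then $k_{u^1}\in L^1(B)$. If, moreover, all critical points of $u^1$ in $\Omega$ are isolated, and $c\in\mathbb R$ is such that $\{u^1=c\}\cap B$ is nonempty and contains no critical point of $u^1$, then $$L(c):=\mathcal H^1(\{z\in\Omega: u^1(z)=c\}\cap B)\le\int_{\Omega\cap B}|k_{u^1}|+2\pi R.$$ The same holds for $u^2$, with $|f|$ replaced by $|g|$ in the lower bounds of (1)–(4) and $k_{u^1}$ by $k_{u^2}$. -/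

import Mathlib

open MeasureTheory Set Filter
open scoped Topology ContDiff

noncomputable section

/-! The plane is `ℂ` with its real structure, `z = x + i y`. -/

/-- First partial derivative in `x` of a function on the plane. -/
def dx (v : ℂ → ℝ) (z : ℂ) : ℝ := fderiv ℝ v z 1

/-- First partial derivative in `y` of a function on the plane. -/
def dy (v : ℂ → ℝ) (z : ℂ) : ℝ := fderiv ℝ v z Complex.I

/-- The Euclidean norm of the gradient. -/
def gradNorm (v : ℂ → ℝ) (z : ℂ) : ℝ := Real.sqrt (dx v z ^ 2 + dy v z ^ 2)

/-- The Euclidean (Hilbert–Schmidt) norm of the Hessian. -/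
def hessNorm (v : ℂ → ℝ) (z : ℂ) : ℝ :=
  Real.sqrt (dx (dx v) z ^ 2 + dy (dx v) z ^ 2 + dx (dy v) z ^ 2 + dy (dy v) z ^ 2)

/-- The curvature function `-div (∇v / |∇v|)` of the level curves of a `C²` function `v`, written
out at the points where `∇v ≠ 0`. At critical points the value is `0` by convention. -/
def levelCurvature (v : ℂ → ℝ) (z : ℂ) : ℝ :=
  -((dy v z ^ 2 * dx (dx v) z - 2 * dx v z * dy v z * dy (dx v) z + dx v z ^ 2 * dy (dy v) z)
    / gradNorm v z ^ 3)

/-- The complex gradient `(v_x - i v_y) / 2`. -/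
def complexGrad (v : ℂ → ℝ) (z : ℂ) : ℂ := (1 / 2 : ℂ) * ((dx v z : ℂ) - Complex.I * (dy v z : ℂ))

/-- The Wirtinger derivative `F_z = (F_x - i F_y) / 2`. -/
def wirtingerZ (F : ℂ → ℂ) (z : ℂ) : ℂ :=
  (1 / 2 : ℂ) * (fderiv ℝ F z 1 - Complex.I * fderiv ℝ F z Complex.I)

/-- The `i`-th coordinate function of a planar map. -/
def coord (u : ℂ → Fin 2 → ℝ) (i : Fin 2) (z : ℂ) : ℝ := u z i

/-- `|Du|`, where `|Du|² = |∇u¹|² + |∇u²|²`. -/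
def jacNorm (u : ℂ → Fin 2 → ℝ) (z : ℂ) : ℝ :=
  Real.sqrt (gradNorm (coord u 0) z ^ 2 + gradNorm (coord u 1) z ^ 2)

/-- Real-valued test functions, smooth with compact support in `U`. -/
def IsTest (U : Set ℂ) (φ : ℂ → ℝ) : Prop :=
  ContDiff ℝ ∞ φ ∧ HasCompactSupport φ ∧ tsupport φ ⊆ U

/-- Weak form of `div (|Du|^{p-2} Du) = 0` in `Ω`, for a continuously differentiable map `u` and
`1 < p < ∞`. The field `|Du|^{p-2} ∇uⁱ` is zero where `Du = 0`, also for `p < 2`. -/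
def IsPHarmonicMap (p : ℝ) (Ω : Set ℂ) (u : ℂ → Fin 2 → ℝ) : Prop :=
  ∀ (i : Fin 2) (φ : ℂ → ℝ), IsTest Ω φ →
    ∫ z in Ω, jacNorm u z ^ (p - 2) *
      (dx (coord u i) z * dx φ z + dy (coord u i) z * dy φ z) = 0

/-- `G` is the weak derivative of `F` in the direction `e` on `U`. -/
def IsWeakDeriv (U : Set ℂ) (e : ℂ) (F G : ℂ → ℂ) : Prop :=
  ∀ φ : ℂ → ℝ, IsTest U φ →
    ∫ z in U, ((fderiv ℝ φ z e : ℝ) : ℂ) * F z = -∫ z in U, ((φ z : ℝ) : ℂ) * G z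

/-- `F` is quasiregular in the open set `U`: it is continuous, it lies in `W^{1,2}_loc(U)`, and
`|F_{z̄}| ≤ k |F_z|` almost everywhere in `U` for some constant `k < 1`. -/
def QuasiregularOn (F : ℂ → ℂ) (U : Set ℂ) : Prop :=
  ContinuousOn F U ∧
  ∃ Fx Fy : ℂ → ℂ,
    (∀ K : Set ℂ, IsCompact K → K ⊆ U →
      MemLp Fx 2 (volume.restrict K) ∧ MemLp Fy 2 (volume.restrict K)) ∧
    IsWeakDeriv U 1 F Fx ∧ IsWeakDeriv U Complex.I F Fy ∧
    ∃ k : ℝ, 0 ≤ k ∧ k < 1 ∧ ∀ᵐ z ∂(volume.restrict U),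
      ‖(1 / 2 : ℂ) * (Fx z + Complex.I * Fy z)‖ ≤
        k * ‖(1 / 2 : ℂ) * (Fx z - Complex.I * Fy z)‖

/-- The critical points of `v` in `Ω`. -/
def criticalSet (v : ℂ → ℝ) (Ω : Set ℂ) : Set ℂ := {z ∈ Ω | dx v z = 0 ∧ dy v z = 0}

end

/-! Everything reduces to one fact about `v = coord u i`: `|H(v)| / |∇v|` is integrable on the ball
and `∇v ≠ 0` a.e. there. Integrability of the curvature follows at once, since it is the Hessian
evaluated on the unit tangent, divided by `|∇v|`.

The length bound is the divergence theorem for the unit normal field, tested with `h(v) χ`, where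
`h` is a steep ramp from `-1/2` to `1/2` at the level `c` and `χ` is a radial cutoff. This bounds `∫
h'(v) χ |∇v|` by half of `∫ |k| + ∫ |∇χ|`, with `∫ |∇χ| ≤ 2πR`. As the normal field is singular at
critical points, it is replaced by `∇v / √(|∇v|² + δ²)`, and `δ → 0` by dominated convergence
(`integral_flux_le`). Conversely the length is at most twice the layer integral `∫ h'(v) |∇v|` up to
a small error (`eventually_hausdorffMeasure_le`). This crude factor 2 cancels the factor 1/2 from
`|h| ≤ 1/2`, so no exact coarea formula is needed.

For the integrability: in (1) the Hessian is in `L²` and `|∇v|` is bounded below. In (2) the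
`p`-harmonic system, elliptic for `p > 1`, bounds the full Hessians by `f_z` and `g_z`
(`laplacian_sq_le`). In (3) and (4) the Hessian is bounded because `u` is `C²` on a neighbourhood of
the closed ball, and in (4) the power `|z - z₀|^{-α}` is integrable in the plane. -/

/-! ### Partial derivatives and integration by parts. -/

theorem ContDiffOn.fderiv_apply_const {v : ℂ → ℝ} {Ω : Set ℂ} (hΩ : IsOpen Ω)
    (hv : ContDiffOn ℝ 2 v Ω) (e : ℂ) : ContDiffOn ℝ 1 (fun z => fderiv ℝ v z e) Ω :=
  (hv.fderiv_of_isOpen hΩ (by norm_num)).clm_apply contDiffOn_const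

theorem contDiffOn_dx {v : ℂ → ℝ} {Ω : Set ℂ} (hΩ : IsOpen Ω) (hv : ContDiffOn ℝ 2 v Ω) :
    ContDiffOn ℝ 1 (dx v) Ω := hv.fderiv_apply_const hΩ 1

theorem contDiffOn_dy {v : ℂ → ℝ} {Ω : Set ℂ} (hΩ : IsOpen Ω) (hv : ContDiffOn ℝ 2 v Ω) :
    ContDiffOn ℝ 1 (dy v) Ω := hv.fderiv_apply_const hΩ Complex.I

theorem continuousOn_fderiv_apply {v : ℂ → ℝ} {Ω : Set ℂ} (hΩ : IsOpen Ω)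
    (hv : ContDiffOn ℝ 1 v Ω) (e : ℂ) : ContinuousOn (fun z => fderiv ℝ v z e) Ω :=
  (hv.continuousOn_fderiv_of_isOpen hΩ le_rfl).clm_apply continuousOn_const

theorem continuousOn_dx {v : ℂ → ℝ} {Ω : Set ℂ} (hΩ : IsOpen Ω) (hv : ContDiffOn ℝ 1 v Ω) :
    ContinuousOn (dx v) Ω := continuousOn_fderiv_apply hΩ hv 1

theorem continuousOn_dy {v : ℂ → ℝ} {Ω : Set ℂ} (hΩ : IsOpen Ω) (hv : ContDiffOn ℝ 1 v Ω) :
    ContinuousOn (dy v) Ω := continuousOn_fderiv_apply hΩ hv Complex.I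

theorem dx_dy_eq_dy_dx {v : ℂ → ℝ} {Ω : Set ℂ} (hΩ : IsOpen Ω) (hv : ContDiffOn ℝ 2 v Ω)
    {z : ℂ} (hz : z ∈ Ω) : dx (dy v) z = dy (dx v) z := by
  have hvz : ContDiffAt ℝ 2 v z := hv.contDiffAt (hΩ.mem_nhds hz)
  have hs : IsSymmSndFDerivAt ℝ v z := hvz.isSymmSndFDerivAt (by simp)
  have hd : DifferentiableAt ℝ (fderiv ℝ v) z :=
    (hvz.fderiv_right (m := 1) (by norm_num)).differentiableAt (by norm_num)
  have key : ∀ e w : ℂ, fderiv ℝ (fun y => fderiv ℝ v y e) z w = fderiv ℝ (fderiv ℝ v) z w e := by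
    intro e w
    rw [fderiv_clm_apply hd (differentiableAt_const e)]
    simp
  have h := hs.eq 1 Complex.I
  rw [← key, ← key] at h
  exact h

theorem DifferentiableAt.hasLineDerivAt_fderiv {f : ℂ → ℝ} {z : ℂ} (h : DifferentiableAt ℝ f z)
    (e : ℂ) : HasLineDerivAt ℝ f (fderiv ℝ f z e) z e :=
  h.hasFDerivAt.hasLineDerivAt e

theorem integrable_of_continuousOn_of_eq_zero {F : ℂ → ℝ} {K : Set ℂ} (hK : IsCompact K)
    (hF : ContinuousOn F K) (h0 : ∀ z, z ∉ K → F z = 0) : Integrable F :=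
  (hF.integrableOn_compact hK).integrable_of_forall_notMem_eq_zero h0

theorem gradNorm_nonneg (v : ℂ → ℝ) (z : ℂ) : 0 ≤ gradNorm v z := Real.sqrt_nonneg _

theorem gradNorm_sq (v : ℂ → ℝ) (z : ℂ) : gradNorm v z ^ 2 = dx v z ^ 2 + dy v z ^ 2 :=
  Real.sq_sqrt (by positivity)

theorem hessNorm_nonneg (v : ℂ → ℝ) (z : ℂ) : 0 ≤ hessNorm v z := Real.sqrt_nonneg _

theorem hessNorm_sq (v : ℂ → ℝ) (z : ℂ) : hessNorm v z ^ 2 =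
    dx (dx v) z ^ 2 + dy (dx v) z ^ 2 + dx (dy v) z ^ 2 + dy (dy v) z ^ 2 :=
  Real.sq_sqrt (by positivity)

/-- The weak divergence identity for a `C¹` field `(P, Q)` tested with `ζ`. -/
theorem integral_test_mul_div {ζ P Q P' Q' : ℂ → ℝ} {Ω : Set ℂ}
    (hζ : ContDiff ℝ 1 ζ) (hζc : HasCompactSupport ζ) (hζΩ : tsupport ζ ⊆ Ω)
    (hP : ∀ z ∈ Ω, HasLineDerivAt ℝ P (P' z) z 1)
    (hQ : ∀ z ∈ Ω, HasLineDerivAt ℝ Q (Q' z) z Complex.I)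
    (hPc : ContinuousOn P Ω) (hQc : ContinuousOn Q Ω)
    (hPc' : ContinuousOn P' Ω) (hQc' : ContinuousOn Q' Ω) :
    ∫ z, (dx ζ z * P z + dy ζ z * Q z) = - ∫ z, ζ z * (P' z + Q' z) := by
  have hz : ∀ z, z ∉ tsupport ζ → ζ z = 0 := fun z h => image_eq_zero_of_notMem_tsupport h
  have hz' : ∀ e z, z ∉ tsupport ζ → fderiv ℝ ζ z e = 0 := by
    intro e z h
    have : fderiv ℝ ζ z = 0 := by
      by_contra hne
      exact h (support_fderiv_subset ℝ hne)
    simp [this]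
  have hζd : ∀ e, Continuous (fun z => fderiv ℝ ζ z e) := fun e =>
    (hζ.continuous_fderiv (by norm_num)).clm_apply continuous_const
  have I1 : ∀ {A : ℂ → ℝ}, ContinuousOn A Ω → Integrable (fun z => ζ z * A z) := fun hA =>
    integrable_of_continuousOn_of_eq_zero hζc.isCompact
      (hζ.continuous.continuousOn.mul (hA.mono hζΩ)) (fun z h => by simp [hz z h])
  have I2 : ∀ {A : ℂ → ℝ} (e : ℂ), ContinuousOn A Ω →
      Integrable (fun z => fderiv ℝ ζ z e * A z) := fun e hA =>
    integrable_of_continuousOn_of_eq_zero hζc.isCompact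
      ((hζd e).continuousOn.mul (hA.mono hζΩ)) (fun z h => by simp [hz' e z h])
  have key : ∀ {A A' : ℂ → ℝ} (e : ℂ), (∀ z ∈ Ω, HasLineDerivAt ℝ A (A' z) z e) →
      ContinuousOn A Ω → ContinuousOn A' Ω →
      ∫ z, ζ z * A' z = - ∫ z, fderiv ℝ ζ z e * A z := by
    intro A A' e hA hAc hAc'
    exact integral_bilinear_hasLineDerivAt_right_eq_neg_left_of_integrable
      (B := ContinuousLinearMap.mul ℝ ℝ) (I2 e hAc) (I1 hAc') (I1 hAc)
      (fun z _ => (hζ.differentiable (by norm_num) z).hasLineDerivAt_fderiv e)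
      (fun z hz => hA z (hζΩ hz))
  have e1 : ∫ z, (dx ζ z * P z + dy ζ z * Q z) = (∫ z, dx ζ z * P z) + ∫ z, dy ζ z * Q z :=
    integral_add (I2 1 hPc) (I2 Complex.I hQc)
  have e2 : ∫ z, ζ z * (P' z + Q' z) = (∫ z, ζ z * P' z) + ∫ z, ζ z * Q' z := by
    rw [← integral_add (I1 hPc') (I1 hQc')]
    exact integral_congr_ae (ae_of_all _ fun z => by ring)
  rw [e1, e2, key 1 hP hPc hPc', key Complex.I hQ hQc hQc']
  simp only [dx, dy]
  ring

/-! ### The regularized unit normal field and its divergence. -/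

/-- Line derivative of a component of the regularized unit field. -/
theorem HasLineDerivAt.div_sqrt_sq_add {a b : ℂ → ℝ} {a' b' δ : ℝ} {z e : ℂ} (hδ : 0 < δ)
    (ha : HasLineDerivAt ℝ a a' z e) (hb : HasLineDerivAt ℝ b b' z e) :
    HasLineDerivAt ℝ (fun w => a w / Real.sqrt (a w ^ 2 + b w ^ 2 + δ ^ 2))
      ((a' * (b z ^ 2 + δ ^ 2) - a z * b z * b') / Real.sqrt (a z ^ 2 + b z ^ 2 + δ ^ 2) ^ 3)
      z e := by
  unfold HasLineDerivAt at *
  have hpos : 0 < a z ^ 2 + b z ^ 2 + δ ^ 2 := by positivity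
  have hsq := Real.sq_sqrt hpos.le
  have hW : HasDerivAt (fun t : ℝ => Real.sqrt (a (z + t • e) ^ 2 + b (z + t • e) ^ 2 + δ ^ 2)) _ 0 :=
    (((ha.pow 2).add (hb.pow 2)).add_const (δ ^ 2)).sqrt (by simpa using hpos.ne')
  have hs : Real.sqrt (a z ^ 2 + b z ^ 2 + δ ^ 2) ≠ 0 := (Real.sqrt_pos.2 hpos).ne'
  refine (ha.div hW (by simpa using hs)).congr_deriv ?_
  simp only [zero_smul, add_zero, Pi.add_apply, Pi.pow_apply]
  set s := Real.sqrt (a z ^ 2 + b z ^ 2 + δ ^ 2) with hsdef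
  clear_value s
  have : b z ^ 2 + δ ^ 2 = s ^ 2 - a z ^ 2 := by linarith
  rw [this]
  field_simp
  push_cast
  ring

/-- The left side is the Hessian form on the rotated gradient `(b, -a)`; the operator norm is at
most the Hilbert–Schmidt norm. -/
theorem abs_hess_quadratic_le (a b p q s : ℝ) :
    |b ^ 2 * p - 2 * a * b * q + a ^ 2 * s| ≤
      Real.sqrt (p ^ 2 + q ^ 2 + q ^ 2 + s ^ 2) * (a ^ 2 + b ^ 2) := by
  apply abs_le_of_sq_le_sq _ (by positivity)
  rw [mul_pow, Real.sq_sqrt (by positivity)]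
  nlinarith [sq_nonneg (b ^ 2 * q + a * b * p), sq_nonneg (b ^ 2 * s - a ^ 2 * p),
    sq_nonneg (a * b * s + a ^ 2 * q), sq_nonneg (b ^ 2 * q + a * b * p),
    sq_nonneg (a * b * q * 2), sq_nonneg (a * b * s), sq_nonneg (a * b * p)]

theorem abs_trace_le (p q s : ℝ) :
    |p + s| ≤ 2 * Real.sqrt (p ^ 2 + q ^ 2 + q ^ 2 + s ^ 2) := by
  apply abs_le_of_sq_le_sq _ (by positivity)
  rw [mul_pow, Real.sq_sqrt (by positivity)]
  nlinarith [sq_nonneg (p - s), sq_nonneg q, sq_nonneg p, sq_nonneg s]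

/-- The divergence of `∇v / √(|∇v|² + δ²)`. -/
noncomputable def regDiv (v : ℂ → ℝ) (δ : ℝ) (z : ℂ) : ℝ :=
  (dy v z ^ 2 * dx (dx v) z - 2 * dx v z * dy v z * dy (dx v) z + dx v z ^ 2 * dy (dy v) z
    + δ ^ 2 * (dx (dx v) z + dy (dy v) z)) / Real.sqrt (dx v z ^ 2 + dy v z ^ 2 + δ ^ 2) ^ 3

theorem hessNorm_eq {v : ℂ → ℝ} {z : ℂ} (h : dx (dy v) z = dy (dx v) z) :
    hessNorm v z = Real.sqrt (dx (dx v) z ^ 2 + dy (dx v) z ^ 2 + dy (dx v) z ^ 2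
      + dy (dy v) z ^ 2) := by
  rw [hessNorm, h]

theorem abs_levelCurvature_le {v : ℂ → ℝ} {z : ℂ} (h : dx (dy v) z = dy (dx v) z) :
    |levelCurvature v z| ≤ hessNorm v z / gradNorm v z := by
  rw [levelCurvature, abs_neg, abs_div, abs_of_nonneg (pow_nonneg (gradNorm_nonneg v z) 3)]
  rcases (gradNorm_nonneg v z).eq_or_lt with h0 | h0
  -- At a critical point both sides are 0, because division by zero gives 0.
  · simp [← h0]
  have := abs_hess_quadratic_le (dx v z) (dy v z) (dx (dx v) z) (dy (dx v) z) (dy (dy v) z)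
  rw [← hessNorm_eq h, ← gradNorm_sq] at this
  rw [div_le_div_iff₀ (by positivity) h0]
  calc _ ≤ hessNorm v z * gradNorm v z ^ 2 * gradNorm v z := by gcongr
    _ = _ := by ring

/-- With `W² = |∇v|² + δ²` the numerator is at most `|H| (|∇v|² + 2δ²) ≤ 2 |H| W²`. The resulting
bound does not depend on `δ`, so it serves as the dominating function for `δ → 0`. -/
theorem abs_regDiv_le {v : ℂ → ℝ} {z : ℂ} {δ : ℝ} (h : dx (dy v) z = dy (dx v) z)
    (hg : gradNorm v z ≠ 0) :
    |regDiv v δ z| ≤ 2 * (hessNorm v z / gradNorm v z) := by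
  have h0 : 0 < gradNorm v z := (gradNorm_nonneg v z).lt_of_ne' hg
  have hH := hessNorm_nonneg v z
  rw [regDiv, ← gradNorm_sq]
  set W := Real.sqrt (gradNorm v z ^ 2 + δ ^ 2) with hW
  have hWsq : W ^ 2 = gradNorm v z ^ 2 + δ ^ 2 := Real.sq_sqrt (by positivity)
  have hW0 : 0 < W := Real.sqrt_pos.2 (by positivity)
  have hWG : gradNorm v z ≤ W := Real.le_sqrt_of_sq_le (by nlinarith [sq_nonneg δ])
  have h1 := abs_hess_quadratic_le (dx v z) (dy v z) (dx (dx v) z) (dy (dx v) z) (dy (dy v) z)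
  have h2 := abs_trace_le (dx (dx v) z) (dy (dx v) z) (dy (dy v) z)
  rw [← hessNorm_eq h] at h1 h2
  rw [← gradNorm_sq] at h1
  rw [abs_div, abs_of_pos (pow_pos hW0 3)]
  calc _ ≤ (hessNorm v z * gradNorm v z ^ 2 + δ ^ 2 * (2 * hessNorm v z)) / W ^ 3 := by
        gcongr
        refine (abs_add_le _ _).trans (add_le_add h1 ?_)
        rw [abs_mul, abs_of_nonneg (sq_nonneg δ)]
        gcongr
    _ ≤ (2 * hessNorm v z * W ^ 2) / W ^ 3 := by
        gcongr
        rw [hWsq]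
        nlinarith [mul_nonneg hH (sq_nonneg (gradNorm v z))]
    _ = 2 * (hessNorm v z / W) := by field_simp
    _ ≤ _ := by gcongr

theorem tendsto_regDiv {v : ℂ → ℝ} {z : ℂ} (hg : gradNorm v z ≠ 0) {δ : ℕ → ℝ}
    (hδ : Tendsto δ atTop (𝓝 0)) :
    Tendsto (fun n => regDiv v (δ n) z) atTop (𝓝 (-levelCurvature v z)) := by
  have : Continuous (fun t : ℝ => dx v z ^ 2 + dy v z ^ 2 + t ^ 2) := by fun_prop
  have hc : ContinuousAt (fun t : ℝ => regDiv v t z) 0 := by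
    unfold regDiv
    apply ContinuousAt.div
    · fun_prop
    · fun_prop
    · simpa [gradNorm] using hg
  have h := hc.tendsto.comp hδ
  have h0 : regDiv v 0 z = -levelCurvature v z := by
    simp [regDiv, levelCurvature, gradNorm]
  rwa [h0] at h

/-! ### The flux estimate across a level. -/

theorem fderiv_eq_zero_of_notMem_tsupport {χ : ℂ → ℝ} {z : ℂ} (h : z ∉ tsupport χ) :
    fderiv ℝ χ z = 0 := by
  by_contra hne
  exact h (support_fderiv_subset ℝ hne)

theorem tsupport_mul_subset_of_right (F χ : ℂ → ℝ) :
    tsupport (fun z => F z * χ z) ⊆ tsupport χ :=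
  closure_mono fun z hz => by
    simp only [Function.mem_support] at hz ⊢
    exact right_ne_zero_of_mul hz

theorem contDiff_mul_of_tsupport_subset {F χ : ℂ → ℝ} {Ω : Set ℂ} (hΩ : IsOpen Ω)
    (hF : ContDiffOn ℝ 1 F Ω) (hχ : ContDiff ℝ 1 χ) (hχΩ : tsupport χ ⊆ Ω) :
    ContDiff ℝ 1 (fun z => F z * χ z) := by
  refine contDiff_iff_contDiffAt.2 fun z => ?_
  by_cases hz : z ∈ tsupport χ
  swap
  · refine contDiffAt_const (c := (0 : ℝ)) |>.congr_of_eventuallyEq ?_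
    filter_upwards [(isClosed_tsupport χ).isOpen_compl.mem_nhds hz] with w hw
    rw [image_eq_zero_of_notMem_tsupport hw, mul_zero]
  exact (hF.contDiffAt (hΩ.mem_nhds (hχΩ hz))).mul
    hχ.contDiffAt

theorem continuousOn_gradNorm {v : ℂ → ℝ} {Ω : Set ℂ} (hΩ : IsOpen Ω)
    (hv : ContDiffOn ℝ 1 v Ω) : ContinuousOn (gradNorm v) Ω :=
  (((continuousOn_dx hΩ hv).pow 2).add ((continuousOn_dy hΩ hv).pow 2)).sqrt

theorem continuousOn_hessNorm {v : ℂ → ℝ} {Ω : Set ℂ} (hΩ : IsOpen Ω)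
    (hv : ContDiffOn ℝ 2 v Ω) : ContinuousOn (hessNorm v) Ω :=
  (((((continuousOn_dx hΩ (contDiffOn_dx hΩ hv)).pow 2).add
    ((continuousOn_dy hΩ (contDiffOn_dx hΩ hv)).pow 2)).add
    ((continuousOn_dx hΩ (contDiffOn_dy hΩ hv)).pow 2)).add
    ((continuousOn_dy hΩ (contDiffOn_dy hΩ hv)).pow 2)).sqrt

theorem continuousOn_regDiv {v : ℂ → ℝ} {Ω : Set ℂ} (hΩ : IsOpen Ω)
    (hv : ContDiffOn ℝ 2 v Ω) {δ : ℝ} (hδ : 0 < δ) : ContinuousOn (regDiv v δ) Ω := by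
  have h1 := continuousOn_dx hΩ (hv.of_le one_le_two)
  have h2 := continuousOn_dy hΩ (hv.of_le one_le_two)
  have h3 := continuousOn_dx hΩ (contDiffOn_dx hΩ hv)
  have h4 := continuousOn_dy hΩ (contDiffOn_dx hΩ hv)
  have h5 := continuousOn_dy hΩ (contDiffOn_dy hΩ hv)
  unfold regDiv
  refine ContinuousOn.div (by fun_prop) (by fun_prop) fun z _ => ?_
  positivity

theorem gradNorm_le_sqrt (v : ℂ → ℝ) (δ : ℝ) (z : ℂ) :
    gradNorm v z ≤ Real.sqrt (dx v z ^ 2 + dy v z ^ 2 + δ ^ 2) :=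
  Real.sqrt_le_sqrt (by nlinarith [sq_nonneg δ])

theorem abs_grad_mul_grad_le (χ v : ℂ → ℝ) (z : ℂ) :
    |dx χ z * dx v z + dy χ z * dy v z| ≤ gradNorm χ z * gradNorm v z := by
  apply abs_le_of_sq_le_sq _ (mul_nonneg (gradNorm_nonneg _ _) (gradNorm_nonneg _ _))
  rw [mul_pow, gradNorm_sq, gradNorm_sq]
  nlinarith [sq_nonneg (dx χ z * dy v z - dy χ z * dx v z)]

/-- Test the field `∇v / W` with `ζ = h(v) χ`. Of the two terms of `∇ζ`, `h'(v) χ ∇v` produces the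
left side, and `h(v) ∇χ` costs at most `|∇χ| / 2` since the field has length at most 1. The
divergence side is controlled by `|ζ| ≤ 1/2`. -/
theorem integral_regularized_flux_le {v χ : ℂ → ℝ} {h : ℝ → ℝ} {Ω B : Set ℂ} {δ : ℝ}
    (hΩ : IsOpen Ω) (hv : ContDiffOn ℝ 2 v Ω) (hBΩ : B ⊆ Ω) (hBm : MeasurableSet B)
    (hh : ContDiff ℝ 1 h) (hh1 : ∀ t, |h t| ≤ 1 / 2)
    (hχ : ContDiff ℝ 1 χ) (hχc : HasCompactSupport χ) (hχB : tsupport χ ⊆ B)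
    (hχ0 : ∀ z, 0 ≤ χ z) (hχ1 : ∀ z, χ z ≤ 1) (hδ : 0 < δ)
    (hint : IntegrableOn (regDiv v δ) B) :
    ∫ z, deriv h (v z) * χ z * (gradNorm v z ^ 2 / Real.sqrt (dx v z ^ 2 + dy v z ^ 2 + δ ^ 2)) ≤
      1 / 2 * ((∫ z in B, |regDiv v δ z|) + ∫ z, gradNorm χ z) := by
  have hχΩ := hχB.trans hBΩ
  have hvd := hv.of_le one_le_two
  set W : ℂ → ℝ := fun z => Real.sqrt (dx v z ^ 2 + dy v z ^ 2 + δ ^ 2) with hW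
  have hW0 : ∀ z, 0 < W z := fun z => Real.sqrt_pos.2 (by positivity)
  set F : ℂ → ℝ := fun z => h (v z) with hFdef
  have hF : ContDiffOn ℝ 1 F Ω := hh.comp_contDiffOn hvd
  set ζ : ℂ → ℝ := fun z => F z * χ z with hζdef
  have hζ : ContDiff ℝ 1 ζ := contDiff_mul_of_tsupport_subset hΩ hF hχ hχΩ
  have hζs : tsupport ζ ⊆ tsupport χ := tsupport_mul_subset_of_right F χ
  have hζc : HasCompactSupport ζ := hχc.isCompact.of_isClosed_subset (isClosed_tsupport _) hζs
  have c1 := continuousOn_dx hΩ hvd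
  have c2 := continuousOn_dy hΩ hvd
  have cW : ContinuousOn W Ω := by fun_prop
  have hdiv := integral_test_mul_div (P := fun z => dx v z / W z) (Q := fun z => dy v z / W z)
    (P' := fun z => (dx (dx v) z * (dy v z ^ 2 + δ ^ 2) - dx v z * dy v z * dx (dy v) z)
      / W z ^ 3)
    (Q' := fun z => (dy (dy v) z * (dx v z ^ 2 + δ ^ 2) - dy v z * dx v z * dy (dx v) z)
      / W z ^ 3) hζ hζc (hζs.trans hχΩ)
    (fun z hz => HasLineDerivAt.div_sqrt_sq_add hδ
      ((((contDiffOn_dx hΩ hv).contDiffAt (hΩ.mem_nhds hz)).differentiableAt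
        (by norm_num)).hasLineDerivAt_fderiv 1)
      ((((contDiffOn_dy hΩ hv).contDiffAt (hΩ.mem_nhds hz)).differentiableAt
        (by norm_num)).hasLineDerivAt_fderiv 1))
    (fun z hz => by
      have := HasLineDerivAt.div_sqrt_sq_add hδ
        ((((contDiffOn_dy hΩ hv).contDiffAt (hΩ.mem_nhds hz)).differentiableAt
          (by norm_num)).hasLineDerivAt_fderiv Complex.I)
        ((((contDiffOn_dx hΩ hv).contDiffAt (hΩ.mem_nhds hz)).differentiableAt
          (by norm_num)).hasLineDerivAt_fderiv Complex.I)
      simp only [add_comm (dy v _ ^ 2)] at this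
      exact this)
    (c1.div cW fun z _ => (hW0 z).ne') (c2.div cW fun z _ => (hW0 z).ne')
    (by
      have h3 := continuousOn_dx hΩ (contDiffOn_dx hΩ hv)
      have h4 := continuousOn_dx hΩ (contDiffOn_dy hΩ hv)
      exact ContinuousOn.div (by fun_prop) (by fun_prop) fun z _ => (pow_pos (hW0 z) 3).ne')
    (by
      have h3 := continuousOn_dy hΩ (contDiffOn_dx hΩ hv)
      have h4 := continuousOn_dy hΩ (contDiffOn_dy hΩ hv)
      exact ContinuousOn.div (by fun_prop) (by fun_prop) fun z _ => (pow_pos (hW0 z) 3).ne')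
  have hright : ∫ z, ζ z * ((dx (dx v) z * (dy v z ^ 2 + δ ^ 2) - dx v z * dy v z * dx (dy v) z)
      / W z ^ 3 + (dy (dy v) z * (dx v z ^ 2 + δ ^ 2) - dy v z * dx v z * dy (dx v) z)
      / W z ^ 3) = ∫ z in B, ζ z * regDiv v δ z := by
    rw [← setIntegral_eq_integral_of_forall_compl_eq_zero (s := B)]
    · refine setIntegral_congr_fun hBm fun z hz => ?_
      simp only [regDiv]
      rw [dx_dy_eq_dy_dx hΩ hv (hBΩ hz)]
      simp only [hW]
      ring
    · intro z hz
      rw [image_eq_zero_of_notMem_tsupport (fun h' => hz (hχB (hζs h'))), zero_mul]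
  rw [hright] at hdiv
  have hζabs : ∀ z, |ζ z| ≤ 1 / 2 := by
    intro z
    rw [hζdef, abs_mul, abs_of_nonneg (hχ0 z)]
    nlinarith [hh1 (v z), abs_nonneg (h (v z)), hχ0 z, hχ1 z]
  have hb1 : -∫ z in B, ζ z * regDiv v δ z ≤ 1 / 2 * ∫ z in B, |regDiv v δ z| := by
    rw [← integral_const_mul]
    refine (neg_le_abs _).trans ((abs_integral_le_integral_abs).trans ?_)
    refine integral_mono_of_nonneg (ae_of_all _ fun z => abs_nonneg _) (hint.abs.const_mul _)
      (ae_of_all _ fun z => ?_)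
    simp only [abs_mul]
    exact mul_le_mul_of_nonneg_right (hζabs z) (abs_nonneg _)
  have hpt : ∀ z, deriv h (v z) * χ z * (gradNorm v z ^ 2 / W z) ≤
      (dx ζ z * (dx v z / W z) + dy ζ z * (dy v z / W z)) + 1 / 2 * gradNorm χ z := by
    intro z
    by_cases hz : z ∈ tsupport χ
    · have hvz : DifferentiableAt ℝ v z :=
        (hvd.contDiffAt (hΩ.mem_nhds (hχΩ hz))).differentiableAt (by norm_num)
      have hFz : ∀ e, fderiv ℝ F z e = deriv h (v z) * fderiv ℝ v z e := by
        intro e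
        have : HasFDerivAt F (deriv h (v z) • fderiv ℝ v z) z :=
          ((hh.differentiable (by norm_num)) (v z)).hasDerivAt.comp_hasFDerivAt z hvz.hasFDerivAt
        rw [this.fderiv]; simp
      have hζz : ∀ e, fderiv ℝ ζ z e = deriv h (v z) * fderiv ℝ v z e * χ z
          + h (v z) * fderiv ℝ χ z e := by
        intro e
        have hFd : DifferentiableAt ℝ F z :=
          (hF.contDiffAt (hΩ.mem_nhds (hχΩ hz))).differentiableAt (by norm_num)
        rw [hζdef, fderiv_fun_mul hFd ((hχ.differentiable (by norm_num)) z)]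
        simp [hFz]
        ring
      have e1 : dx ζ z * (dx v z / W z) + dy ζ z * (dy v z / W z) =
          deriv h (v z) * χ z * (gradNorm v z ^ 2 / W z)
          + h (v z) * ((dx χ z * dx v z + dy χ z * dy v z) / W z) := by
        rw [gradNorm_sq]
        have a1 := hζz 1
        have a2 := hζz Complex.I
        simp only [dx, dy] at *
        rw [a1, a2]
        ring
      have e2 : |h (v z) * ((dx χ z * dx v z + dy χ z * dy v z) / W z)| ≤
          1 / 2 * gradNorm χ z := by
        rw [abs_mul]
        refine mul_le_mul (hh1 _) ?_ (abs_nonneg _) (by norm_num)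
        rw [abs_div, abs_of_pos (hW0 z), div_le_iff₀ (hW0 z)]
        refine (abs_grad_mul_grad_le χ v z).trans ?_
        exact mul_le_mul_of_nonneg_left (gradNorm_le_sqrt v δ z) (gradNorm_nonneg _ _)
      rw [e1]
      linarith [(abs_le.1 e2).1]
    · have h1 : χ z = 0 := image_eq_zero_of_notMem_tsupport hz
      have h2 : fderiv ℝ ζ z = 0 := fderiv_eq_zero_of_notMem_tsupport fun h' => hz (hζs h')
      simp [h1, dx, dy, h2, gradNorm_nonneg]
  have hdχ : Continuous (gradNorm χ) :=
    continuousOn_univ.1 (continuousOn_gradNorm isOpen_univ hχ.contDiffOn)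
  have i0 : Integrable (gradNorm χ) :=
    integrable_of_continuousOn_of_eq_zero hχc.isCompact hdχ.continuousOn fun z hz => by
      simp [gradNorm, dx, dy, fderiv_eq_zero_of_notMem_tsupport hz]
  have i1 : Integrable (fun z => dx ζ z * (dx v z / W z) + dy ζ z * (dy v z / W z)) := by
    have d1 : Continuous (dx ζ) :=
      continuousOn_univ.1 (continuousOn_dx isOpen_univ hζ.contDiffOn)
    have d2 : Continuous (dy ζ) :=
      continuousOn_univ.1 (continuousOn_dy isOpen_univ hζ.contDiffOn)
    refine integrable_of_continuousOn_of_eq_zero hχc.isCompact ?_ fun z hz => ?_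
    · refine ContinuousOn.mono ?_ hχΩ
      exact (d1.continuousOn.mul (c1.div cW fun z _ => (hW0 z).ne')).add
        (d2.continuousOn.mul (c2.div cW fun z _ => (hW0 z).ne'))
    · simp [dx, dy, fderiv_eq_zero_of_notMem_tsupport fun h' => hz (hζs h')]
  have i2 : Integrable (fun z => deriv h (v z) * χ z * (gradNorm v z ^ 2 / W z)) := by
    refine integrable_of_continuousOn_of_eq_zero hχc.isCompact ?_ fun z hz => ?_
    · refine ContinuousOn.mono ?_ hχΩ
      exact (((hh.continuous_deriv le_rfl).comp_continuousOn hvd.continuousOn).mul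
        hχ.continuous.continuousOn).mul
        (((continuousOn_gradNorm hΩ hvd).pow 2).div cW fun z _ => (hW0 z).ne')
    · simp [image_eq_zero_of_notMem_tsupport hz]
  calc _ ≤ ∫ z, ((dx ζ z * (dx v z / W z) + dy ζ z * (dy v z / W z)) + 1 / 2 * gradNorm χ z) :=
        integral_mono i2 (i1.add (i0.const_mul _)) hpt
    _ = (-∫ z in B, ζ z * regDiv v δ z) + 1 / 2 * ∫ z, gradNorm χ z := by
        rw [integral_add i1 (i0.const_mul _), hdiv, integral_const_mul]
    _ ≤ _ := by rw [mul_add]; linarith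

/-- A ramp `h` across the level gives a bound on the weighted area of the transition layer by the
total curvature and the total variation of the cutoff. -/
theorem integral_flux_le {v χ : ℂ → ℝ} {h : ℝ → ℝ} {Ω B : Set ℂ}
    (hΩ : IsOpen Ω) (hv : ContDiffOn ℝ 2 v Ω) (hBΩ : B ⊆ Ω) (hBm : MeasurableSet B)
    (hint : IntegrableOn (fun z => hessNorm v z / gradNorm v z) B)
    (hreg : ∀ᵐ z ∂volume.restrict B, gradNorm v z ≠ 0)
    (hh : ContDiff ℝ 1 h) (hh1 : ∀ t, |h t| ≤ 1 / 2)
    (hχ : ContDiff ℝ 1 χ) (hχc : HasCompactSupport χ) (hχB : tsupport χ ⊆ B)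
    (hχ0 : ∀ z, 0 ≤ χ z) (hχ1 : ∀ z, χ z ≤ 1) :
    ∫ z, deriv h (v z) * χ z * gradNorm v z ≤
      1 / 2 * ((∫ z in B, |levelCurvature v z|) + ∫ z, gradNorm χ z) := by
  have hvd := hv.of_le one_le_two
  have hχΩ := hχB.trans hBΩ
  set δ : ℕ → ℝ := fun n => 1 / ((n : ℝ) + 1) with hδdef
  have hδ0 : ∀ n, 0 < δ n := fun n => by positivity
  have hδ : Tendsto δ atTop (𝓝 0) := tendsto_one_div_add_atTop_nhds_zero_nat
  have hbound : ∀ n, ∀ᵐ z ∂volume.restrict B,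
      |regDiv v (δ n) z| ≤ 2 * (hessNorm v z / gradNorm v z) := by
    intro n
    filter_upwards [hreg, ae_restrict_mem hBm] with z hz hzB
    exact abs_regDiv_le (dx_dy_eq_dy_dx hΩ hv (hBΩ hzB)) hz
  have hmeas : ∀ n, AEStronglyMeasurable (regDiv v (δ n)) (volume.restrict B) := fun n =>
    ((continuousOn_regDiv hΩ hv (hδ0 n)).mono hBΩ).aestronglyMeasurable hBm
  have hri : ∀ n, IntegrableOn (regDiv v (δ n)) B := fun n =>
    Integrable.mono' (hint.const_mul 2) (hmeas n) (hbound n)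
  have t1 : Tendsto (fun n => ∫ z in B, |regDiv v (δ n) z|) atTop
      (𝓝 (∫ z in B, |levelCurvature v z|)) := by
    refine tendsto_integral_of_dominated_convergence _ (fun n => (hmeas n).norm)
      (hint.const_mul 2) (fun n => ?_) ?_
    · filter_upwards [hbound n] with z hz
      simpa using hz
    · filter_upwards [hreg] with z hz
      simpa using (tendsto_regDiv hz hδ).abs
  have hcont : ContinuousOn (fun z => deriv h (v z) * χ z) Ω :=
    ((hh.continuous_deriv le_rfl).comp_continuousOn hvd.continuousOn).mul
      hχ.continuous.continuousOn
  have t2 : Tendsto (fun n => ∫ z, deriv h (v z) * χ z *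
      (gradNorm v z ^ 2 / Real.sqrt (dx v z ^ 2 + dy v z ^ 2 + δ n ^ 2))) atTop
      (𝓝 (∫ z, deriv h (v z) * χ z * gradNorm v z)) := by
    refine tendsto_integral_of_dominated_convergence
      (fun z => |deriv h (v z) * χ z * gradNorm v z|) (fun n => ?_) ?_ (fun n => ?_) ?_
    · refine (integrable_of_continuousOn_of_eq_zero hχc.isCompact (ContinuousOn.mono ?_ hχΩ)
        fun z hz => ?_).aestronglyMeasurable
      · have c1 := continuousOn_dx hΩ hvd
        have c2 := continuousOn_dy hΩ hvd
        refine hcont.mul (((continuousOn_gradNorm hΩ hvd).pow 2).div (by fun_prop) fun z _ => ?_)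
        have := hδ0 n
        positivity
      · simp [image_eq_zero_of_notMem_tsupport hz]
    · exact (integrable_of_continuousOn_of_eq_zero hχc.isCompact
        ((hcont.mul (continuousOn_gradNorm hΩ hvd)).mono hχΩ)
        fun z hz => by simp [image_eq_zero_of_notMem_tsupport hz]).abs
    · refine ae_of_all _ fun z => ?_
      rw [Real.norm_eq_abs, abs_mul, abs_mul (deriv h (v z) * χ z)]
      refine mul_le_mul_of_nonneg_left ?_ (abs_nonneg _)
      have hp : 0 < Real.sqrt (dx v z ^ 2 + dy v z ^ 2 + δ n ^ 2) :=
        Real.sqrt_pos.2 (by have := hδ0 n; positivity)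
      rw [abs_of_nonneg (by positivity), abs_of_nonneg (gradNorm_nonneg v z), div_le_iff₀ hp, sq]
      exact mul_le_mul_of_nonneg_left (gradNorm_le_sqrt v _ z) (gradNorm_nonneg v z)
    -- Convergence holds at every point: at a critical point of `v` the quotient and its limit are
    -- both 0.
    · refine ae_of_all _ fun z => Tendsto.const_mul _ ?_
      rcases eq_or_ne (gradNorm v z) 0 with h0 | h0
      · simp [h0]
      · have hc : ContinuousAt (fun t : ℝ => gradNorm v z ^ 2 /
            Real.sqrt (dx v z ^ 2 + dy v z ^ 2 + t ^ 2)) 0 := by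
          apply ContinuousAt.div
          · fun_prop
          · fun_prop
          · simpa [gradNorm] using h0
        have := hc.tendsto.comp hδ
        have e : gradNorm v z ^ 2 / Real.sqrt (dx v z ^ 2 + dy v z ^ 2 + 0 ^ 2)
            = gradNorm v z := by
          have : Real.sqrt (dx v z ^ 2 + dy v z ^ 2 + 0 ^ 2) = gradNorm v z := by simp [gradNorm]
          rw [this]; field_simp
        rwa [e] at this
  refine le_of_tendsto_of_tendsto' t2 ((t1.add_const _).const_mul _) fun n => ?_
  exact integral_regularized_flux_le hΩ hv hBΩ hBm hh hh1 hχ hχc hχB hχ0 hχ1 (hδ0 n) (hri n)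

/-! ### Radial cutoffs and ramps. -/

/-- The profile is composed with the squared distance, which is smooth at the centre too. -/
theorem gradNorm_radial {q : ℝ → ℝ} (hq : Differentiable ℝ q) (z₀ z : ℂ) :
    gradNorm (fun w => q (‖w - z₀‖ ^ 2)) z = |deriv q (‖z - z₀‖ ^ 2)| * (2 * ‖z - z₀‖) := by
  have h1 : HasFDerivAt (fun w : ℂ => ‖w - z₀‖ ^ 2) (2 • innerSL ℝ (z - z₀)) z :=
    (HasFDerivAt.comp (g := fun x : ℂ => ‖x‖ ^ 2) (f := fun w => w - z₀) z
      (hasStrictFDerivAt_norm_sq (z - z₀)).hasFDerivAt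
      ((hasFDerivAt_id z).sub_const z₀)).congr_fderiv (ContinuousLinearMap.comp_id _)
  have h2 : HasFDerivAt (fun w => q (‖w - z₀‖ ^ 2))
      (deriv q (‖z - z₀‖ ^ 2) • (2 • innerSL ℝ (z - z₀))) z :=
    (hq _).hasDerivAt.comp_hasFDerivAt z h1
  have e : ‖z - z₀‖ ^ 2 = (z - z₀).re ^ 2 + (z - z₀).im ^ 2 := by
    rw [← Complex.normSq_eq_norm_sq, Complex.normSq_apply]; ring
  rw [gradNorm, dx, dy, h2.fderiv]
  rw [Real.sqrt_eq_iff_mul_self_eq (by positivity) (by positivity)]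
  set d := deriv q (‖z - z₀‖ ^ 2)
  have : |d| * (2 * ‖z - z₀‖) * (|d| * (2 * ‖z - z₀‖)) = 4 * |d| ^ 2 * ‖z - z₀‖ ^ 2 := by ring
  rw [this, sq_abs, e]
  simp [Complex.inner]
  ring

/-- Radial cutoff functions with total variation at most the perimeter of the ball. -/
theorem exists_radial_cutoff (z₀ : ℂ) {r R : ℝ} (hr : 0 ≤ r) (hrR : r < R) :
    ∃ χ : ℂ → ℝ, ContDiff ℝ 1 χ ∧ HasCompactSupport χ ∧ tsupport χ ⊆ Metric.ball z₀ R ∧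
      (∀ z, 0 ≤ χ z) ∧ (∀ z, χ z ≤ 1) ∧ (∀ z ∈ Metric.closedBall z₀ r, χ z = 1) ∧
      ∫ z, gradNorm χ z ≤ 2 * Real.pi * R := by
  obtain ⟨s, hrs, hsR⟩ := exists_between hrR
  have hs : 0 < s := hr.trans_lt hrs
  have hd : 0 < s ^ 2 - r ^ 2 := by nlinarith
  set q : ℝ → ℝ := fun t => Real.smoothTransition ((s ^ 2 - t) / (s ^ 2 - r ^ 2)) with hqdef
  have hq : ContDiff ℝ 1 q := Real.smoothTransition.contDiff.comp (by fun_prop)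
  have hqd : Differentiable ℝ q := hq.differentiable (by norm_num)
  have hanti : Antitone q := fun a b hab => Real.smoothTransition.monotone (by gcongr)
  have hq' : ∀ t, deriv q t ≤ 0 := fun t => hanti.deriv_nonpos
  have hq0 : ∀ t, s ^ 2 ≤ t → q t = 0 := fun t ht =>
    Real.smoothTransition.zero_of_nonpos (div_nonpos_of_nonpos_of_nonneg (by linarith) hd.le)
  have hq1 : ∀ t, t ≤ r ^ 2 → q t = 1 := fun t ht =>
    Real.smoothTransition.one_of_one_le ((one_le_div hd).2 (by linarith))
  have hsupp : tsupport (fun z => q (‖z - z₀‖ ^ 2)) ⊆ Metric.closedBall z₀ s := by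
    refine closure_minimal (fun z hz => ?_) Metric.isClosed_closedBall
    by_contra h
    rw [mem_closedBall_iff_norm, not_le] at h
    exact hz (hq0 _ (by gcongr))
  refine ⟨fun z => q (‖z - z₀‖ ^ 2), ?_, ?_, ?_, fun z => Real.smoothTransition.nonneg _,
    fun z => Real.smoothTransition.le_one _, fun z hz => hq1 _ ?_, ?_⟩
  · exact hq.comp ((contDiff_norm_sq ℝ).comp (contDiff_id.sub contDiff_const))
  · exact (isCompact_closedBall z₀ s).of_isClosed_subset (isClosed_tsupport _) hsupp
  · exact hsupp.trans (Metric.closedBall_subset_ball hsR)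
  · rw [mem_closedBall_iff_norm] at hz
    gcongr
  -- `g` rises from `-1` to `0`, so `∫ g' = 1`. In polar coordinates the total variation is `2π ∫ y
  -- g'(y) dy`, and `g'` vanishes for `y ≥ R`.
  set g : ℝ → ℝ := fun y => -q (y ^ 2) with hgdef
  set g' : ℝ → ℝ := fun y => |deriv q (y ^ 2)| * (2 * y) with hg'def
  have hg : ∀ y, HasDerivAt g (g' y) y := by
    intro y
    have := ((hqd (y ^ 2)).hasDerivAt.comp y (hasDerivAt_pow 2 y)).neg
    refine this.congr_deriv ?_
    simp only [hg'def, abs_of_nonpos (hq' _)]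
    simp
  have hg'0 : ∀ y ∈ Ioi (0 : ℝ), 0 ≤ g' y := fun y hy =>
    mul_nonneg (abs_nonneg _) (by linarith [mem_Ioi.1 hy])
  have hlim : Tendsto g atTop (𝓝 0) := by
    refine tendsto_const_nhds.congr' ?_
    filter_upwards [eventually_ge_atTop s] with y hy
    simp [hgdef, hq0 (y ^ 2) (by gcongr)]
  have hcg : ContinuousWithinAt g (Ici 0) 0 := (hg 0).continuousAt.continuousWithinAt
  have hI : IntegrableOn g' (Ioi 0) :=
    integrableOn_Ioi_deriv_of_nonneg hcg (fun y _ => hg y) hg'0 hlim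
  have hval : ∫ y in Ioi 0, g' y = 1 := by
    rw [integral_Ioi_of_hasDerivAt_of_nonneg hcg (fun y _ => hg y) hg'0 hlim]
    simp [hgdef, hq1 0 (sq_nonneg r)]
  have hle : ∫ y in Ioi (0 : ℝ), y * g' y ≤ R := by
    calc ∫ y in Ioi (0 : ℝ), y * g' y ≤ ∫ y in Ioi (0 : ℝ), R * g' y := by
          refine integral_mono_of_nonneg ?_ (hI.const_mul R) ?_
          · filter_upwards [ae_restrict_mem measurableSet_Ioi] with y hy
            exact mul_nonneg (le_of_lt hy) (hg'0 y hy)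
          · filter_upwards [ae_restrict_mem measurableSet_Ioi] with y hy
            rcases le_total y R with h | h
            · exact mul_le_mul_of_nonneg_right h (hg'0 y hy)
            · have hev : q =ᶠ[𝓝 (y ^ 2)] fun _ => 0 := by
                filter_upwards [lt_mem_nhds (show s ^ 2 < y ^ 2 by gcongr; linarith)] with t ht
                exact hq0 t ht.le
              have : deriv q (y ^ 2) = 0 := by rw [hev.deriv_eq]; simp
              simp [hg'def, this]
      _ = R := by rw [integral_const_mul, hval, mul_one]
  calc ∫ z, gradNorm (fun z => q (‖z - z₀‖ ^ 2)) z = ∫ z, g' ‖z - z₀‖ := by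
        simp only [gradNorm_radial hqd, hg'def]
    _ = ∫ z : ℂ, g' ‖z‖ := integral_sub_right_eq_self (fun z : ℂ => g' ‖z‖) z₀
    _ = 2 * Real.pi * ∫ y in Ioi (0 : ℝ), y * g' y := by
        rw [integral_fun_norm_addHaar volume g']
        simp [Complex.finrank_real_complex, Measure.real, Complex.volume_ball]
        ring
    _ ≤ _ := by
        gcongr

/-- A smooth monotone ramp from `-1/2` to `1/2` across `[c - ε, c + ε]`. -/
noncomputable def ramp (c ε t : ℝ) : ℝ := Real.smoothTransition ((t - c) / (2 * ε) + 1 / 2) - 1 / 2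

theorem contDiff_ramp (c ε : ℝ) : ContDiff ℝ 1 (ramp c ε) :=
  (Real.smoothTransition.contDiff.comp (by fun_prop)).sub contDiff_const

theorem abs_ramp_le (c ε t : ℝ) : |ramp c ε t| ≤ 1 / 2 := by
  rw [ramp, abs_le]
  constructor
  · linarith [Real.smoothTransition.nonneg ((t - c) / (2 * ε) + 1 / 2)]
  · linarith [Real.smoothTransition.le_one ((t - c) / (2 * ε) + 1 / 2)]

theorem monotone_ramp (c : ℝ) {ε : ℝ} (hε : 0 < ε) : Monotone (ramp c ε) := fun a b hab =>
  sub_le_sub_right (Real.smoothTransition.monotone (by gcongr)) _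

theorem ramp_of_le {c ε t : ℝ} (hε : 0 < ε) (ht : t ≤ c - ε) : ramp c ε t = -(1 / 2) := by
  rw [ramp, Real.smoothTransition.zero_of_nonpos, zero_sub]
  have : (t - c) / (2 * ε) ≤ -(1 / 2) := by
    rw [div_le_iff₀ (by positivity)]; linarith
  linarith

theorem ramp_of_ge {c ε t : ℝ} (hε : 0 < ε) (ht : c + ε ≤ t) : ramp c ε t = 1 / 2 := by
  rw [ramp, Real.smoothTransition.one_of_one_le]
  · norm_num
  have : 1 / 2 ≤ (t - c) / (2 * ε) := by
    rw [le_div_iff₀ (by positivity)]; linarith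
  linarith

/-! ### Length of a regular level set against the mass of thin layers. -/

theorem fderiv_apply_eq (v : ℂ → ℝ) (z e : ℂ) : fderiv ℝ v z e = e.re * dx v z + e.im * dy v z := by
  have : e = e.re • (1 : ℂ) + e.im • Complex.I := by
    apply Complex.ext <;> simp
  conv_lhs => rw [this]
  simp only [map_add, map_smul, smul_eq_mul, dx, dy]

theorem abs_fderiv_apply_le_gradNorm (v : ℂ → ℝ) (z : ℂ) {e : ℂ} (he : ‖e‖ = 1) :
    |fderiv ℝ v z e| ≤ gradNorm v z := by
  apply abs_le_of_sq_le_sq _ (gradNorm_nonneg v z)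
  have h1 : e.re ^ 2 + e.im ^ 2 = 1 := by
    have := Complex.normSq_eq_norm_sq e
    rw [he, Complex.normSq_apply] at this; linarith
  rw [gradNorm_sq, fderiv_apply_eq]
  have : dx v z ^ 2 + dy v z ^ 2 = (e.re ^ 2 + e.im ^ 2) * (dx v z ^ 2 + dy v z ^ 2) := by
    rw [h1, one_mul]
  rw [this]
  nlinarith [sq_nonneg (e.re * dy v z - e.im * dx v z)]

/-- Near a regular point the derivative in a suitable unit direction `τ i` is bounded below and
dominates the derivative in the orthogonal direction `τ`. -/
theorem exists_direction {v : ℂ → ℝ} {Ω : Set ℂ} (hΩ : IsOpen Ω) (hv : ContDiffOn ℝ 1 v Ω) {p : ℂ}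
    (hp : p ∈ Ω) (hreg : gradNorm v p ≠ 0) :
    ∃ τ : ℂ, ‖τ‖ = 1 ∧ ∃ ρ > 0, ∃ m > 0, Metric.ball p ρ ⊆ Ω ∧ ∀ z ∈ Metric.ball p ρ,
      m ≤ fderiv ℝ v z (τ * Complex.I) ∧ |fderiv ℝ v z τ| ≤ fderiv ℝ v z (τ * Complex.I) := by
  set G := gradNorm v p with hG
  have hG0 : 0 < G := (gradNorm_nonneg v p).lt_of_ne' hreg
  have hGsq : G ^ 2 = dx v p ^ 2 + dy v p ^ 2 := gradNorm_sq v p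
  -- `τ` is the unit tangent of the level curve at `p`, and `τ i` is the unit normal `∇v / |∇v|`.
  set τ : ℂ := ⟨dy v p / G, -(dx v p / G)⟩ with hω
  have hωn : ‖τ‖ = 1 := by
    have h2 : ‖τ‖ ^ 2 = 1 := by
      rw [← Complex.normSq_eq_norm_sq, Complex.normSq_apply]
      simp only [hω]
      field_simp
      linarith
    nlinarith [norm_nonneg τ]
  have h1 : fderiv ℝ v p (τ * Complex.I) = G := by
    rw [fderiv_apply_eq]
    simp only [hω, Complex.mul_re, Complex.mul_im, Complex.I_re, Complex.I_im]
    field_simp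
    linarith
  have h2 : fderiv ℝ v p τ = 0 := by
    rw [fderiv_apply_eq]
    simp only [hω]
    ring
  have c1 := (continuousOn_fderiv_apply hΩ hv (τ * Complex.I)).continuousAt (hΩ.mem_nhds hp)
  have c2 := (continuousOn_fderiv_apply hΩ hv τ).continuousAt (hΩ.mem_nhds hp)
  have e1 : ∀ᶠ z in 𝓝 p, G / 2 < fderiv ℝ v z (τ * Complex.I) :=
    c1.eventually (lt_mem_nhds (by simp only [h1]; linarith))
  have e2 : ∀ᶠ z in 𝓝 p, |fderiv ℝ v z τ| < G / 2 :=
    c2.abs.eventually (gt_mem_nhds (by simp only [h2, abs_zero]; linarith))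
  obtain ⟨ρ, hρ, hρs⟩ := Metric.eventually_nhds_iff_ball.1 (e1.and (e2.and (hΩ.mem_nhds hp)))
  exact ⟨τ, hωn, ρ, hρ, G / 2, by positivity, fun z hz => (hρs z hz).2.2,
    fun z hz => ⟨(hρs z hz).1.le, ((hρs z hz).2.1.trans (hρs z hz).1).le⟩⟩

/-- Rotated real coordinates on the plane. -/
noncomputable def frame (τ : ℂ) (q : ℝ × ℝ) : ℂ := τ * (q.1 + q.2 * Complex.I)

/-- First coordinate in the rotated frame. -/
noncomputable def frameFst (τ z : ℂ) : ℝ := ((starRingEnd ℂ) τ * z).re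

/-- Second coordinate in the rotated frame. -/
noncomputable def frameSnd (τ z : ℂ) : ℝ := ((starRingEnd ℂ) τ * z).im

theorem frame_frameFst_frameSnd {τ : ℂ} (hω : ‖τ‖ = 1) (z : ℂ) :
    frame τ (frameFst τ z, frameSnd τ z) = z := by
  simp only [frame, frameFst, frameSnd, Complex.re_add_im]
  rw [← mul_assoc, Complex.mul_conj, Complex.normSq_eq_norm_sq, hω]
  simp

theorem frame_eq_smul (τ : ℂ) (q : ℝ × ℝ) :
    frame τ q = q.1 • τ + q.2 • (τ * Complex.I) := by
  simp only [frame, Complex.real_smul]; ring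

theorem measurePreserving_frame {τ : ℂ} (hω : ‖τ‖ = 1) : MeasurePreserving (frame τ) := by
  have h1 := Complex.volume_preserving_equiv_real_prod.symm
  let t : Circle := ⟨τ, mem_sphere_zero_iff_norm.2 hω⟩
  have h3 := (rotation t).measurePreserving.comp h1
  convert h3 using 1
  ext q
  rw [Function.comp_apply, rotation_apply, Complex.measurableEquivRealProd_symm_apply,
    Complex.mk_eq_add_mul_I, frame]

theorem continuous_frameFst (τ : ℂ) : Continuous (frameFst τ) := by
  unfold frameFst; fun_prop

/-- By the mean value theorem some point of the chord has derivative zero along the chord. Since the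
`τ i` derivative dominates there, the chord has slope at most one over the `τ` axis: the level set
is a Lipschitz graph. -/
theorem norm_le_two_mul_frameFst {v : ℂ → ℝ} {τ p : ℂ} {ρ m : ℝ} (hω : ‖τ‖ = 1) (hm : 0 < m)
    (hd : ∀ z ∈ Metric.ball p ρ, DifferentiableAt ℝ v z)
    (hb : ∀ z ∈ Metric.ball p ρ,
      m ≤ fderiv ℝ v z (τ * Complex.I) ∧ |fderiv ℝ v z τ| ≤ fderiv ℝ v z (τ * Complex.I))
    {z w : ℂ} (hz : z ∈ Metric.ball p ρ) (hw : w ∈ Metric.ball p ρ) (hzw : v z = v w) :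
    dist z w ≤ 2 * dist (frameFst τ z) (frameFst τ w) := by
  obtain ⟨ξ, hξ, hξe⟩ := domain_mvt (f := v) (f' := fun z => fderiv ℝ v z)
    (fun x hx => (hd x hx).hasFDerivAt.hasFDerivWithinAt) (convex_ball p ρ) hw hz
  have hξb := (convex_ball p ρ).segment_subset hw hz hξ
  set x := frameFst τ (z - w) with hx
  set y := frameSnd τ (z - w) with hy
  have hdec : z - w = x • τ + y • (τ * Complex.I) := by
    rw [← frame_eq_smul (q := (x, y)), hx, hy, frame_frameFst_frameSnd hω]
  obtain ⟨h1, h2⟩ := hb ξ hξb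
  set α := fderiv ℝ v ξ (τ * Complex.I)
  set β := fderiv ℝ v ξ τ
  have h0 : x * β + y * α = 0 := by
    have : fderiv ℝ v ξ (z - w) = 0 := by rw [← hξe, hzw, sub_self]
    rw [hdec] at this
    simpa only [map_add, map_smul, smul_eq_mul] using this
  have hα : 0 < α := hm.trans_le h1
  have hyx : |y| ≤ |x| := by
    have : |y| * α ≤ |x| * α := by
      calc |y| * α = |y * α| := by rw [abs_mul, abs_of_pos hα]
        _ = |x * β| := by rw [show y * α = -(x * β) by linarith, abs_neg]
        _ = |x| * |β| := abs_mul _ _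
        _ ≤ |x| * α := by gcongr
    exact le_of_mul_le_mul_right this hα
  have hfst : dist (frameFst τ z) (frameFst τ w) = |x| := by
    rw [Real.dist_eq, hx]
    simp only [frameFst, mul_sub, Complex.sub_re]
  rw [hfst, dist_eq_norm, hdec]
  calc ‖x • τ + y • (τ * Complex.I)‖ ≤ ‖x • τ‖ + ‖y • (τ * Complex.I)‖ := norm_add_le _ _
    _ = |x| + |y| := by simp [hω]
    _ ≤ _ := by linarith

theorem hausdorffMeasure_le_two_mul_volume_image {A : Set ℂ} {π : ℂ → ℝ}
    (h : ∀ z ∈ A, ∀ w ∈ A, dist z w ≤ 2 * dist (π z) (π w)) :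
    Measure.hausdorffMeasure 1 A ≤ 2 * volume (π '' A) := by
  have hanti : AntilipschitzWith 2 (fun z : A => π z) :=
    AntilipschitzWith.of_le_mul_dist fun z w => h z z.2 w w.2
  have h1 := hanti.le_hausdorffMeasure_image zero_le_one univ
  have h2 : (fun z : A => π z) '' univ = π '' A := by
    ext; simp
  have h3 := (isometry_subtype_coe (s := A)).hausdorffMeasure_image (Or.inl zero_le_one) univ
  rw [image_univ, Subtype.range_coe] at h3
  rw [h2, hausdorffMeasure_real] at h1
  rw [h3]
  simpa using h1

/-- The density of the transition layer of a ramp of width `ε` at level `c`. -/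
noncomputable def layerDensity (v : ℂ → ℝ) (c ε : ℝ) (z : ℂ) : ENNReal :=
  ENNReal.ofReal (deriv (ramp c ε) (v z) * gradNorm v z)

/-- With slope at least `m`, `φ` moves by at least `m η ≥ ε` on each side of `y₀`. The ramp is thus
crossed completely, and the fundamental theorem of calculus gives exactly 1. -/
theorem one_le_lintegral_deriv_ramp {φ φ' : ℝ → ℝ} {c y₀ η m ε : ℝ} (hη : 0 < η) (hm : 0 < m)
    (hε : 0 < ε) (hεm : ε ≤ m * η) (hφ : ∀ y ∈ Icc (y₀ - η) (y₀ + η), HasDerivAt φ (φ' y) y)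
    (hc' : ContinuousOn φ' (Icc (y₀ - η) (y₀ + η)))
    (hb : ∀ y ∈ Icc (y₀ - η) (y₀ + η), m ≤ φ' y) (h0 : φ y₀ = c) :
    1 ≤ ∫⁻ y in Icc (y₀ - η) (y₀ + η), ENNReal.ofReal (deriv (ramp c ε) (φ y) * φ' y) := by
  have hle : y₀ - η ≤ y₀ + η := by linarith
  have hφc : ContinuousOn φ (Icc (y₀ - η) (y₀ + η)) := fun y hy =>
    (hφ y hy).continuousAt.continuousWithinAt
  have hmv := (convex_Icc (y₀ - η) (y₀ + η)).mul_sub_le_image_sub_of_le_deriv hφc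
    (fun y hy => (hφ y (interior_subset hy)).differentiableAt.differentiableWithinAt)
    (C := m) (fun y hy => by
      rw [(hφ y (interior_subset hy)).deriv]; exact hb y (interior_subset hy))
  have hy₀ : y₀ ∈ Icc (y₀ - η) (y₀ + η) := ⟨by linarith, by linarith⟩
  have hup := hmv y₀ hy₀ (y₀ + η) (right_mem_Icc.2 hle) (by linarith)
  have hdown := hmv (y₀ - η) (left_mem_Icc.2 hle) y₀ hy₀ (by linarith)
  have e1 : ramp c ε (φ (y₀ + η)) = 1 / 2 := ramp_of_ge hε (by rw [h0] at hup; nlinarith)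
  have e2 : ramp c ε (φ (y₀ - η)) = -(1 / 2) := ramp_of_le hε (by rw [h0] at hdown; nlinarith)
  have hrd : ∀ t, HasDerivAt (ramp c ε) (deriv (ramp c ε) t) t := fun t =>
    ((contDiff_ramp c ε).differentiable (by norm_num) t).hasDerivAt
  have hcont : ContinuousOn (fun y => deriv (ramp c ε) (φ y) * φ' y) (Icc (y₀ - η) (y₀ + η)) :=
    (((contDiff_ramp c ε).continuous_deriv le_rfl).comp_continuousOn hφc).mul hc'
  have hint : ∫ y in (y₀ - η)..(y₀ + η), deriv (ramp c ε) (φ y) * φ' y = 1 := by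
    rw [intervalIntegral.integral_eq_sub_of_hasDerivAt (f := fun y => ramp c ε (φ y))
      (fun y hy => (hrd (φ y)).comp y (hφ y (by rwa [uIcc_of_le hle] at hy)))
      (hcont.intervalIntegrable_of_Icc hle), e1, e2]
    norm_num
  rw [intervalIntegral.integral_of_le hle, ← integral_Icc_eq_integral_Ioc] at hint
  rw [← ofReal_integral_eq_lintegral_ofReal (hcont.integrableOn_Icc), hint, ENNReal.ofReal_one]
  filter_upwards [ae_restrict_mem measurableSet_Icc] with y hy
  exact mul_nonneg (monotone_ramp c hε).deriv_nonneg (hm.le.trans (hb y hy))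

/-- Fubini in the rotated frame: the line in direction `τ i` over each point of the projection of
`A` crosses the whole layer inside `V`, hence contributes at least 1, and the derivative along `τ i`
is at most `|∇v|`. -/
theorem volume_image_le_lintegral_layerDensity {v : ℂ → ℝ} {τ p : ℂ} {ρ m c : ℝ} (hω : ‖τ‖ = 1)
    (hm : 0 < m) (hv : ContDiffOn ℝ 1 v (Metric.ball p ρ))
    (hb : ∀ z ∈ Metric.ball p ρ, m ≤ fderiv ℝ v z (τ * Complex.I))
    {A V : Set ℂ} (hA : IsCompact A) (hAp : A ⊆ Metric.ball p ρ) (hAc : ∀ z ∈ A, v z = c)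
    (hV : IsOpen V) (hAV : A ⊆ V) :
    ∀ᶠ ε in 𝓝[>] (0 : ℝ), volume (frameFst τ '' A) ≤ ∫⁻ z in V, layerDensity v c ε z := by
  set V' := V ∩ Metric.ball p ρ with hV'
  have hV'o : IsOpen V' := hV.inter Metric.isOpen_ball
  -- Compactness makes `η` uniform over `A`, so one range `ε < m η` serves all the lines.
  obtain ⟨η, hη, hηV⟩ := hA.exists_cthickening_subset_open hV'o (subset_inter hAV hAp)
  filter_upwards [Ioo_mem_nhdsGT (show 0 < m * η by positivity)] with ε hε
  have hτI : ‖τ * Complex.I‖ = 1 := by simp [hω]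
  have hdcont : ContinuousOn (fun z => deriv (ramp c ε) (v z) * fderiv ℝ v z (τ * Complex.I)) V' :=
    (((contDiff_ramp c ε).continuous_deriv le_rfl).comp_continuousOn hv.continuousOn |>.mul
      (continuousOn_fderiv_apply Metric.isOpen_ball hv _)).mono inter_subset_right
  set g : ℂ → ENNReal := V'.indicator fun z =>
    ENNReal.ofReal (deriv (ramp c ε) (v z) * fderiv ℝ v z (τ * Complex.I)) with hg
  have hgm : Measurable g := by
    classical
    have := ((ENNReal.continuous_ofReal.comp_continuousOn hdcont).measurable_piecewise
      (continuousOn_const (c := (0 : ENNReal))) hV'o.measurableSet)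
    rw [hg, ← piecewise_eq_indicator]
    exact this
  have hle : ∫⁻ z, g z ≤ ∫⁻ z in V, layerDensity v c ε z := by
    rw [hg, lintegral_indicator hV'o.measurableSet]
    refine (lintegral_mono fun z => ?_).trans (lintegral_mono_set inter_subset_left)
    refine ENNReal.ofReal_le_ofReal (mul_le_mul_of_nonneg_left ?_
      (monotone_ramp c hε.1).deriv_nonneg)
    exact (le_abs_self _).trans (abs_fderiv_apply_le_gradNorm v z hτI)
  refine le_trans ?_ hle
  have hframe := measurePreserving_frame hω
  rw [← hframe.lintegral_comp hgm, Measure.volume_eq_prod,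
    lintegral_prod (fun q => g (frame τ q)) (hgm.comp hframe.measurable).aemeasurable]
  have himg : MeasurableSet (frameFst τ '' A) :=
    (hA.image (continuous_frameFst τ)).isClosed.measurableSet
  rw [← setLIntegral_one, ← lintegral_indicator himg]
  refine lintegral_mono fun x => ?_
  by_cases hx : x ∈ frameFst τ '' A
  swap
  · simp [hx]
  rw [indicator_of_mem hx]
  obtain ⟨a, ha, hax⟩ := hx
  set y₀ := frameSnd τ a with hy₀
  have hmem : ∀ y ∈ Icc (y₀ - η) (y₀ + η), frame τ (x, y) ∈ V' := by
    intro y hy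
    refine hηV (Metric.mem_cthickening_of_dist_le _ a _ _ ha ?_)
    conv_lhs => rw [← frame_frameFst_frameSnd hω a, hax, ← hy₀]
    rw [dist_eq_norm, frame_eq_smul, frame_eq_smul, add_sub_add_left_eq_sub, ← sub_smul,
      norm_smul, hτI, mul_one, Real.norm_eq_abs, abs_le]
    constructor <;> linarith [hy.1, hy.2]
  have hcf : Continuous fun y : ℝ => frame τ (x, y) := by unfold frame; fun_prop
  have hder : ∀ y : ℝ, HasDerivAt (fun y : ℝ => frame τ (x, y)) (τ * Complex.I) y := by
    intro y
    simp only [frame_eq_smul]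
    simpa using ((hasDerivAt_id y).smul_const (τ * Complex.I)).const_add (x • τ)
  have key := one_le_lintegral_deriv_ramp (φ := fun y => v (frame τ (x, y)))
    (φ' := fun y => fderiv ℝ v (frame τ (x, y)) (τ * Complex.I)) (y₀ := y₀) (c := c) hη hm hε.1
    hε.2.le
    (fun y hy => HasFDerivAt.comp_hasDerivAt y (((hv.contDiffAt (Metric.isOpen_ball.mem_nhds
      (hmem y hy).2)).differentiableAt (by norm_num)).hasFDerivAt) (hder y))
    ((continuousOn_fderiv_apply Metric.isOpen_ball hv _).comp hcf.continuousOn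
      fun y hy => (hmem y hy).2)
    (fun y hy => hb _ (hmem y hy).2)
    (by
      rw [hy₀, ← hax]
      simp only [frame_frameFst_frameSnd hω a]
      exact hAc a ha)
  refine key.trans ?_
  rw [← lintegral_indicator measurableSet_Icc]
  refine lintegral_mono fun y => ?_
  by_cases hy : y ∈ Icc (y₀ - η) (y₀ + η)
  · rw [indicator_of_mem hy]
    simp only [hg]
    rw [indicator_of_mem (hmem y hy)]
  · rw [indicator_of_notMem hy]
    exact bot_le

/-- Every regular point has a neighbourhood in which compact pieces of the level set have length
at most twice the weighted area of thin transition layers. -/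
theorem exists_nhd_hausdorffMeasure_le {v : ℂ → ℝ} {Ω : Set ℂ} (hΩ : IsOpen Ω)
    (hv : ContDiffOn ℝ 1 v Ω) {p : ℂ} (hp : p ∈ Ω) (hreg : gradNorm v p ≠ 0) (c : ℝ) :
    ∃ U, IsOpen U ∧ p ∈ U ∧ Measure.hausdorffMeasure 1 (U ∩ {z | v z = c}) < ⊤ ∧
      ∀ A V, IsCompact A → A ⊆ U → (∀ z ∈ A, v z = c) → IsOpen V → A ⊆ V →
        ∀ᶠ ε in 𝓝[>] (0 : ℝ), Measure.hausdorffMeasure 1 A ≤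
          2 * ∫⁻ z in V, layerDensity v c ε z := by
  obtain ⟨τ, hω, ρ, hρ, m, hm, hρΩ, hb⟩ := exists_direction hΩ hv hp hreg
  have hd : ∀ z ∈ Metric.ball p ρ, DifferentiableAt ℝ v z := fun z hz =>
    (hv.contDiffAt (hΩ.mem_nhds (hρΩ hz))).differentiableAt (by norm_num)
  have hH : ∀ A ⊆ Metric.ball p ρ, (∀ z ∈ A, v z = c) →
      Measure.hausdorffMeasure 1 A ≤ 2 * volume (frameFst τ '' A) := fun A hA hc =>
    hausdorffMeasure_le_two_mul_volume_image fun z hz w hw =>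
      norm_le_two_mul_frameFst hω hm hd hb (hA hz) (hA hw) ((hc z hz).trans (hc w hw).symm)
  refine ⟨Metric.ball p ρ, Metric.isOpen_ball, Metric.mem_ball_self hρ, ?_, ?_⟩
  · refine (hH _ inter_subset_left fun z hz => hz.2).trans_lt ?_
    refine ENNReal.mul_lt_top (by simp) ?_
    refine (measure_mono (image_mono (inter_subset_left.trans
      Metric.ball_subset_closedBall))).trans_lt
      ((isCompact_closedBall p ρ).image (continuous_frameFst τ)).measure_lt_top
  · intro A V hA hAp hAc hV hAV
    filter_upwards [volume_image_le_lintegral_layerDensity hω hm (hv.mono hρΩ)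
      (fun z hz => (hb z hz).1) hA hAp hAc hV hAV] with ε hε
    exact (hH A hAp hAc).trans (by gcongr)

/-- Compact regular pieces of a level set have length at most twice the weighted area of thin
transition layers, up to an arbitrarily small error. -/
theorem eventually_hausdorffMeasure_le {v : ℂ → ℝ} {Ω : Set ℂ} (hΩ : IsOpen Ω)
    (hv : ContDiffOn ℝ 1 v Ω) {c : ℝ} {K V : Set ℂ} (hK : IsCompact K) (hKΩ : K ⊆ Ω)
    (hreg : ∀ z ∈ K, gradNorm v z ≠ 0) (hKc : ∀ z ∈ K, v z = c) (hV : IsOpen V) (hKV : K ⊆ V)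
    {θ : ENNReal} (hθ : θ ≠ 0) :
    ∀ᶠ ε in 𝓝[>] (0 : ℝ), Measure.hausdorffMeasure 1 K ≤
      2 * (∫⁻ z in V, layerDensity v c ε z) + θ := by
  -- Compact induction needs a statement about all compact pieces and all open neighbourhoods `V`,
  -- so that pieces can be split and given disjoint layers. Finiteness of the length is carried
  -- along for inner regularity.
  have key : ∃ U, IsOpen U ∧ K ⊆ U ∧ Measure.hausdorffMeasure 1 (U ∩ {z | v z = c}) < ⊤ ∧
      ∀ A V, IsCompact A → A ⊆ U → (∀ z ∈ A, v z = c) → IsOpen V → A ⊆ V → ∀ θ : ENNReal, θ ≠ 0 →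
        ∀ᶠ ε in 𝓝[>] (0 : ℝ), Measure.hausdorffMeasure 1 A ≤
          2 * (∫⁻ z in V, layerDensity v c ε z) + θ := by
    refine hK.induction_on (p := fun E => ∃ U, IsOpen U ∧ E ⊆ U ∧
      Measure.hausdorffMeasure 1 (U ∩ {z | v z = c}) < ⊤ ∧
      ∀ A V, IsCompact A → A ⊆ U → (∀ z ∈ A, v z = c) → IsOpen V → A ⊆ V → ∀ θ : ENNReal, θ ≠ 0 →
        ∀ᶠ ε in 𝓝[>] (0 : ℝ), Measure.hausdorffMeasure 1 A ≤
          2 * (∫⁻ z in V, layerDensity v c ε z) + θ) ?_ ?_ ?_ ?_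
    · refine ⟨∅, isOpen_empty, subset_rfl, by simp, fun A V _ hA _ _ _ θ _ => ?_⟩
      rw [subset_empty_iff.1 hA]
      simp
    · rintro s t hst ⟨U, hU, htU, h⟩
      exact ⟨U, hU, hst.trans htU, h⟩
    · rintro s t ⟨U₁, hU₁, hsU, hfin₁, h₁⟩ ⟨U₂, hU₂, htU, hfin₂, h₂⟩
      refine ⟨U₁ ∪ U₂, hU₁.union hU₂, union_subset_union hsU htU, ?_, ?_⟩
      · rw [union_inter_distrib_right]
        exact (measure_union_le _ _).trans_lt (ENNReal.add_lt_top.2 ⟨hfin₁, hfin₂⟩)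
      intro A V hA hAU hAc hV hAV θ hθ
      have hE : MeasurableSet (A ∩ U₁) := hA.isClosed.measurableSet.inter hU₁.measurableSet
      have hEfin : Measure.hausdorffMeasure 1 (A ∩ U₁) < ⊤ :=
        (measure_mono (fun z hz => ⟨hz.2, hAc z hz.1⟩ : A ∩ U₁ ⊆ U₁ ∩ {z | v z = c})).trans_lt hfin₁
      have hθ3 : θ / 3 ≠ 0 := (ENNReal.div_pos hθ (by simp)).ne'
      -- `A ∩ U₁` need not be compact. Shrinking it to a compact `A₁` costs `θ / 3`, and then `A₁`
      -- and `A \ U₁` have disjoint open neighbourhoods, so no part of the layer is counted twice.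
      obtain ⟨A₁, hA₁E, hA₁, hlt⟩ : ∃ A₁ ⊆ A ∩ U₁, IsCompact A₁ ∧
          Measure.hausdorffMeasure 1 (A ∩ U₁) < Measure.hausdorffMeasure 1 A₁ + θ / 3 := by
        have : IsFiniteMeasure ((Measure.hausdorffMeasure 1 : Measure ℂ).restrict (A ∩ U₁)) :=
          ⟨by rwa [Measure.restrict_apply_univ]⟩
        obtain ⟨A₁, h1, h2, h3⟩ := hE.exists_isCompact_lt_add
          (μ := (Measure.hausdorffMeasure 1 : Measure ℂ).restrict (A ∩ U₁))
          (measure_ne_top _ _) hθ3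
        rw [Measure.restrict_apply_self] at h3
        exact ⟨A₁, h1, h2, h3.trans_le (by gcongr; exact Measure.restrict_le_self)⟩
      have hA₂ : IsCompact (A \ U₁) := hA.diff hU₁
      have hdisj : Disjoint A₁ (A \ U₁) :=
        disjoint_left.2 fun z hz hz' => hz'.2 (hA₁E hz).2
      obtain ⟨V₁, V₂, hV₁, hV₂, hAV₁, hAV₂, hVV⟩ := SeparatedNhds.of_isCompact_isCompact hA₁ hA₂ hdisj
      filter_upwards [h₁ A₁ (V ∩ V₁) hA₁ (fun z hz => (hA₁E hz).2) (fun z hz => hAc z (hA₁E hz).1)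
          (hV.inter hV₁) (subset_inter (fun z hz => hAV (hA₁E hz).1) hAV₁) (θ / 3) hθ3,
        h₂ (A \ U₁) (V ∩ V₂) hA₂ (fun z hz => (hAU hz.1).resolve_left hz.2)
          (fun z hz => hAc z hz.1) (hV.inter hV₂)
          (subset_inter (fun z hz => hAV hz.1) hAV₂) (θ / 3) hθ3] with ε e1 e2
      have hsum : (∫⁻ z in V ∩ V₁, layerDensity v c ε z) + ∫⁻ z in V ∩ V₂, layerDensity v c ε z ≤
          ∫⁻ z in V, layerDensity v c ε z := by
        rw [← lintegral_union (hV.inter hV₂).measurableSet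
          (hVV.mono inter_subset_right inter_subset_right)]
        exact lintegral_mono_set (union_subset inter_subset_left inter_subset_left)
      calc Measure.hausdorffMeasure 1 A
          ≤ Measure.hausdorffMeasure 1 (A ∩ U₁) + Measure.hausdorffMeasure 1 (A \ U₁) :=
            measure_le_inter_add_sdiff _ _ _
        _ ≤ ((2 * (∫⁻ z in V ∩ V₁, layerDensity v c ε z) + θ / 3) + θ / 3) +
              (2 * (∫⁻ z in V ∩ V₂, layerDensity v c ε z) + θ / 3) := by
            gcongr
            exact hlt.le.trans (by gcongr)
        _ = 2 * ((∫⁻ z in V ∩ V₁, layerDensity v c ε z) +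
              ∫⁻ z in V ∩ V₂, layerDensity v c ε z) + (θ / 3 + θ / 3 + θ / 3) := by ring
        _ ≤ _ := by rw [ENNReal.add_thirds]; gcongr
    · intro p hp
      obtain ⟨U, hU, hpU, hfin, h⟩ := exists_nhd_hausdorffMeasure_le hΩ hv (hKΩ hp) (hreg p hp) c
      refine ⟨U, mem_nhdsWithin_of_mem_nhds (hU.mem_nhds hpU), U, hU, subset_rfl, hfin, ?_⟩
      intro A V hA hAU hAc hV hAV θ _
      filter_upwards [h A V hA hAU hAc hV hAV] with ε hε
      exact hε.trans le_self_add
  obtain ⟨U, -, hKU, -, hU⟩ := key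
  exact hU K V hK hKU hKc hV hKV θ hθ

/-! ### The length bound on a ball. -/

/-- Length of a regular level set in a ball is bounded by the total curvature of the level curves
plus the perimeter. -/
theorem hausdorffMeasure_levelSet_le {v : ℂ → ℝ} {Ω : Set ℂ} (hΩ : IsOpen Ω)
    (hv : ContDiffOn ℝ 2 v Ω) {z₀ : ℂ} {R : ℝ} (hB : Metric.ball z₀ R ⊆ Ω)
    (hint : IntegrableOn (fun z => hessNorm v z / gradNorm v z) (Metric.ball z₀ R))
    (hreg : ∀ᵐ z ∂volume.restrict (Metric.ball z₀ R), gradNorm v z ≠ 0) {c : ℝ}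
    (hc : ∀ z ∈ Metric.ball z₀ R, v z = c → gradNorm v z ≠ 0) :
    Measure.hausdorffMeasure 1 (Metric.ball z₀ R ∩ {z | v z = c}) ≤
      ENNReal.ofReal ((∫ z in Metric.ball z₀ R, |levelCurvature v z|) + 2 * Real.pi * R) := by
  have hvd := hv.of_le one_le_two
  set M := (∫ z in Metric.ball z₀ R, |levelCurvature v z|) + 2 * Real.pi * R with hM
  have hcompact : ∀ r, 0 ≤ r → r < R →
      Measure.hausdorffMeasure 1 (Metric.closedBall z₀ r ∩ {z | v z = c}) ≤ ENNReal.ofReal M := by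
    intro r hr hrR
    -- The cutoff equals 1 up to the intermediate radius `s`, so the open ball of radius `s` is a
    -- neighbourhood of the compact piece on which the layer is counted in full.
    obtain ⟨s, hrs, hsR⟩ := exists_between hrR
    obtain ⟨χ, hχ, hχc, hχB, hχ0, hχ1, hχs, hχM⟩ := exists_radial_cutoff z₀ (hr.trans hrs.le) hsR
    have hsub : Metric.closedBall z₀ r ⊆ Metric.ball z₀ R := Metric.closedBall_subset_ball hrR
    have hK : IsCompact (Metric.closedBall z₀ r ∩ {z | v z = c}) :=
      (isCompact_closedBall z₀ r).of_isClosed_subset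
        ((hvd.continuousOn.mono (hsub.trans hB)).preimage_isClosed_of_isClosed
          Metric.isClosed_closedBall isClosed_singleton) inter_subset_left
    have hbound : ∀ ε > 0, 2 * ∫⁻ z in Metric.ball z₀ s, layerDensity v c ε z ≤
        ENNReal.ofReal M := by
      intro ε hε
      have hfl := integral_flux_le hΩ hv hB measurableSet_ball hint hreg (contDiff_ramp c ε)
        (abs_ramp_le c ε) hχ hχc hχB hχ0 hχ1
      set F : ℂ → ℝ := fun z => deriv (ramp c ε) (v z) * χ z * gradNorm v z with hF
      have hF0 : ∀ z, 0 ≤ F z := fun z => mul_nonneg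
        (mul_nonneg (monotone_ramp c hε).deriv_nonneg (hχ0 z)) (gradNorm_nonneg v z)
      have hFi : Integrable F := by
        refine integrable_of_continuousOn_of_eq_zero hχc.isCompact
          (ContinuousOn.mono ?_ (hχB.trans hB)) fun z hz => ?_
        · exact ((((contDiff_ramp c ε).continuous_deriv le_rfl).comp_continuousOn
            hvd.continuousOn).mul hχ.continuous.continuousOn).mul (continuousOn_gradNorm hΩ hvd)
        · simp [hF, image_eq_zero_of_notMem_tsupport hz]
      have h1 : ∫⁻ z in Metric.ball z₀ s, layerDensity v c ε z ≤ ENNReal.ofReal (∫ z, F z) := by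
        rw [ofReal_integral_eq_lintegral_ofReal hFi (ae_of_all _ hF0)]
        refine le_trans (setLIntegral_mono' measurableSet_ball fun z hz => ?_)
          (setLIntegral_le_lintegral (Metric.ball z₀ s) _)
        simp only [layerDensity, hF, hχs z (Metric.ball_subset_closedBall hz), mul_one, le_refl]
      calc 2 * ∫⁻ z in Metric.ball z₀ s, layerDensity v c ε z
          ≤ ENNReal.ofReal 2 * ENNReal.ofReal (∫ z, F z) := by
            rw [ENNReal.ofReal_ofNat]; gcongr
        _ = ENNReal.ofReal (2 * ∫ z, F z) := (ENNReal.ofReal_mul (by norm_num)).symm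
        _ ≤ ENNReal.ofReal M := ENNReal.ofReal_le_ofReal (by linarith)
    refine ENNReal.le_of_forall_pos_le_add fun θ hθ _ => ?_
    have hev := eventually_hausdorffMeasure_le hΩ hvd hK
      (inter_subset_left.trans (hsub.trans hB)) (fun z hz => hc z (hsub hz.1) hz.2)
      (fun z hz => hz.2) Metric.isOpen_ball
      (inter_subset_left.trans (Metric.closedBall_subset_ball hrs))
      (ENNReal.coe_ne_zero.2 hθ.ne')
    obtain ⟨ε, hε1, hε2⟩ := (hev.and self_mem_nhdsWithin).exists
    exact hε1.trans (by gcongr; exact hbound ε hε2)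
  rcases le_or_gt R 0 with hR | hR
  · simp [Metric.ball_eq_empty.2 hR]
  -- The bound is the same for all `r < R`, so it passes to the increasing union of closed balls.
  have hunion : Metric.ball z₀ R ∩ {z | v z = c} =
      ⋃ n : ℕ, Metric.closedBall z₀ (R - R / (n + 1)) ∩ {z | v z = c} := by
    rw [← iUnion_inter]
    congr 1
    ext z
    simp only [mem_iUnion, Metric.mem_ball, Metric.mem_closedBall]
    constructor
    · intro hz
      have ht : Tendsto (fun n : ℕ => R - R / ((n : ℝ) + 1)) atTop (𝓝 R) := by
        have := (tendsto_one_div_add_atTop_nhds_zero_nat (𝕜 := ℝ)).const_mul R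
        simpa [div_eq_mul_inv] using this.const_sub R
      obtain ⟨n, hn⟩ := (ht.eventually (lt_mem_nhds hz)).exists
      exact ⟨n, hn.le⟩
    · rintro ⟨n, hn⟩
      have : 0 < R / ((n : ℝ) + 1) := by positivity
      linarith
  have hmono : Monotone fun n : ℕ => Metric.closedBall z₀ (R - R / ((n : ℝ) + 1)) ∩
      {z | v z = c} := by
    intro a b hab
    refine inter_subset_inter_left _ (Metric.closedBall_subset_closedBall ?_)
    gcongr
  rw [hunion, hmono.measure_iUnion]
  refine iSup_le fun n => hcompact _ ?_ ?_
  · rw [sub_nonneg, div_le_iff₀ (by positivity)]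
    nlinarith [Nat.cast_nonneg (α := ℝ) n]
  · have : 0 < R / ((n : ℝ) + 1) := by positivity
    linarith

/-! ### Ellipticity of the `p`-harmonic system. -/

/-- Since `p - 2 > -1`, the term `(p - 2) X² / 2` absorbs at most half of `J² s²`. The other half is
bounded by `|p - 2| T J² s`, and `J² s` is divided out. -/
theorem laplacian_sq_le_aux {p J s X Y T : ℝ} (hp : 1 < p) (hJ : 0 < J) (hs : 0 ≤ s)
    (hT : 0 ≤ T) (hX : |X| ≤ J * s) (hY : |Y| ≤ T * J * (J * s))
    (h : J ^ 2 * s ^ 2 + (p - 2) * (X ^ 2 / 2 + Y) = 0) :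
    s ≤ 2 * |p - 2| * T := by
  have hX2 : X ^ 2 ≤ (J * s) ^ 2 := sq_le_sq' (by linarith [(abs_le.1 hX).1]) (abs_le.1 hX).2
  have h1 : J ^ 2 * s ^ 2 / 2 ≤ J ^ 2 * s ^ 2 + (p - 2) * (X ^ 2 / 2) := by
    rw [mul_pow] at hX2
    nlinarith [mul_nonneg (sub_pos.2 hp).le (sq_nonneg X)]
  have h2 : -((p - 2) * Y) ≤ |p - 2| * (T * J * (J * s)) := by
    calc -((p - 2) * Y) ≤ |(p - 2) * Y| := neg_le_abs _
      _ = |p - 2| * |Y| := abs_mul _ _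
      _ ≤ _ := by gcongr
  rcases hs.eq_or_lt with h0 | h0
  · rw [← h0]; positivity
  have h3 : (J ^ 2 * s) * s ≤ (J ^ 2 * s) * (2 * |p - 2| * T) := by nlinarith
  exact le_of_mul_le_mul_left h3 (by positivity)

/-- Ellipticity of the non-divergence form of the `p`-harmonic system: the Laplacians are
controlled by the trace-free parts `(β, q)` of the Hessians. -/
theorem laplacian_sq_le {p a₀ b₀ a₁ b₁ D₀ D₁ β₀ β₁ q₀ q₁ : ℝ} (hp : 1 < p)
    (hJ : 0 < a₀ ^ 2 + b₀ ^ 2 + a₁ ^ 2 + b₁ ^ 2) {Nx Ny : ℝ}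
    (hNx : Nx = a₀ * (D₀ / 2 + β₀) + b₀ * q₀ + (a₁ * (D₁ / 2 + β₁) + b₁ * q₁))
    (hNy : Ny = a₀ * q₀ + b₀ * (D₀ / 2 - β₀) + (a₁ * q₁ + b₁ * (D₁ / 2 - β₁)))
    (h₀ : (a₀ ^ 2 + b₀ ^ 2 + a₁ ^ 2 + b₁ ^ 2) * D₀ + (p - 2) * (Nx * a₀ + Ny * b₀) = 0)
    (h₁ : (a₀ ^ 2 + b₀ ^ 2 + a₁ ^ 2 + b₁ ^ 2) * D₁ + (p - 2) * (Nx * a₁ + Ny * b₁) = 0) :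
    D₀ ^ 2 + D₁ ^ 2 ≤ (2 * |p - 2|) ^ 2 * (β₀ ^ 2 + q₀ ^ 2 + β₁ ^ 2 + q₁ ^ 2) := by
  set S := a₀ ^ 2 + b₀ ^ 2 + a₁ ^ 2 + b₁ ^ 2 with hS
  -- `(x, y)` is the sum of the gradients weighted by the Laplacians, and `(ξ, η)` the sum of the
  -- trace-free Hessians applied to the gradients, so that `(Nx, Ny) = (x, y) / 2 + (ξ, η)`.
  set x := D₀ * a₀ + D₁ * a₁ with hx
  set y := D₀ * b₀ + D₁ * b₁ with hy
  set ξ := β₀ * a₀ + q₀ * b₀ + (β₁ * a₁ + q₁ * b₁) with hξ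
  set η := q₀ * a₀ - β₀ * b₀ + (q₁ * a₁ - β₁ * b₁) with hη
  have hX : x ^ 2 + y ^ 2 ≤ S * (D₀ ^ 2 + D₁ ^ 2) := by
    have : S * (D₀ ^ 2 + D₁ ^ 2) - (x ^ 2 + y ^ 2) =
        (D₀ * a₁ - D₁ * a₀) ^ 2 + (D₀ * b₁ - D₁ * b₀) ^ 2 := by rw [hS, hx, hy]; ring
    linarith [sq_nonneg (D₀ * a₁ - D₁ * a₀), sq_nonneg (D₀ * b₁ - D₁ * b₀)]
  have hY : ξ ^ 2 + η ^ 2 ≤ (β₀ ^ 2 + q₀ ^ 2 + β₁ ^ 2 + q₁ ^ 2) * S := by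
    have : (β₀ ^ 2 + q₀ ^ 2 + β₁ ^ 2 + q₁ ^ 2) * S - (ξ ^ 2 + η ^ 2) =
        (β₀ * a₁ - q₀ * b₁ - β₁ * a₀ + q₁ * b₀) ^ 2 +
        (β₀ * b₁ + q₀ * a₁ - β₁ * b₀ - q₁ * a₀) ^ 2 := by rw [hS, hξ, hη]; ring
    linarith [sq_nonneg (β₀ * a₁ - q₀ * b₁ - β₁ * a₀ + q₁ * b₀),
      sq_nonneg (β₀ * b₁ + q₀ * a₁ - β₁ * b₀ - q₁ * a₀)]
  set E := β₀ ^ 2 + q₀ ^ 2 + β₁ ^ 2 + q₁ ^ 2 with hE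
  have hE0 : 0 ≤ E := by positivity
  clear_value S x y ξ η E
  set s := Real.sqrt (D₀ ^ 2 + D₁ ^ 2) with hs
  have hs2 : s ^ 2 = D₀ ^ 2 + D₁ ^ 2 := Real.sq_sqrt (by positivity)
  have hJ2 : Real.sqrt S ^ 2 = S := Real.sq_sqrt hJ.le
  have hT2 : Real.sqrt E ^ 2 = E := Real.sq_sqrt hE0
  have hX2 : Real.sqrt (x ^ 2 + y ^ 2) ^ 2 = x ^ 2 + y ^ 2 := Real.sq_sqrt (by positivity)
  have key := laplacian_sq_le_aux (p := p) (J := Real.sqrt S) (s := s)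
    (X := Real.sqrt (x ^ 2 + y ^ 2)) (Y := ξ * x + η * y) (T := Real.sqrt E) hp
    (Real.sqrt_pos.2 hJ) (Real.sqrt_nonneg _) (Real.sqrt_nonneg _)
    (by
      rw [abs_of_nonneg (Real.sqrt_nonneg _)]
      apply Real.sqrt_le_iff.2 ⟨by positivity, ?_⟩
      rw [mul_pow, hJ2, hs2]; exact hX)
    (by
      apply abs_le_of_sq_le_sq _ (by positivity)
      calc (ξ * x + η * y) ^ 2 ≤ (ξ ^ 2 + η ^ 2) * (x ^ 2 + y ^ 2) := by
            have : (ξ ^ 2 + η ^ 2) * (x ^ 2 + y ^ 2) - (ξ * x + η * y) ^ 2 = (ξ * y - η * x) ^ 2 := by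
              ring
            linarith [sq_nonneg (ξ * y - η * x)]
        _ ≤ (E * S) * (S * (D₀ ^ 2 + D₁ ^ 2)) :=
            mul_le_mul hY hX (by positivity) (mul_nonneg hE0 hJ.le)
        _ = (Real.sqrt E * Real.sqrt S * (Real.sqrt S * s)) ^ 2 := by
            simp only [mul_pow, hJ2, hs2, hT2])
    (by
      rw [hJ2, hs2, hX2]
      -- The two equations are multiplied by the Laplacians `D₀`, `D₁` and added.
      have e : S * (D₀ ^ 2 + D₁ ^ 2) + (p - 2) * ((x ^ 2 + y ^ 2) / 2 + (ξ * x + η * y)) =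
          D₀ * (S * D₀ + (p - 2) * (Nx * a₀ + Ny * b₀)) +
          D₁ * (S * D₁ + (p - 2) * (Nx * a₁ + Ny * b₁)) := by
        rw [hNx, hNy, hx, hy, hξ, hη]; ring
      rw [e, h₀, h₁]; ring)
  rw [← hs2, ← hT2, ← mul_pow]
  gcongr

theorem HasDerivAt.sqrt_four_squares {a b c d : ℝ → ℝ} {a' b' c' d' t : ℝ} (ha : HasDerivAt a a' t)
    (hb : HasDerivAt b b' t) (hc : HasDerivAt c c' t) (hd : HasDerivAt d d' t)
    (h0 : a t ^ 2 + b t ^ 2 + (c t ^ 2 + d t ^ 2) ≠ 0) :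
    HasDerivAt (fun s => Real.sqrt (a s ^ 2 + b s ^ 2 + (c s ^ 2 + d s ^ 2)))
      ((a t * a' + b t * b' + (c t * c' + d t * d')) /
        Real.sqrt (a t ^ 2 + b t ^ 2 + (c t ^ 2 + d t ^ 2))) t := by
  have := (((ha.fun_pow 2).fun_add (hb.fun_pow 2)).fun_add
    ((hc.fun_pow 2).fun_add (hd.fun_pow 2))).sqrt h0
  refine this.congr_deriv ?_
  field_simp
  push_cast
  ring

theorem jacNorm_eq (u : ℂ → Fin 2 → ℝ) (z : ℂ) : jacNorm u z =
    Real.sqrt (dx (coord u 0) z ^ 2 + dy (coord u 0) z ^ 2 +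
      (dx (coord u 1) z ^ 2 + dy (coord u 1) z ^ 2)) := by
  rw [jacNorm, gradNorm_sq, gradNorm_sq]

theorem jacNorm_nonneg (u : ℂ → Fin 2 → ℝ) (z : ℂ) : 0 ≤ jacNorm u z := Real.sqrt_nonneg _

theorem contDiffOn_coord {u : ℂ → Fin 2 → ℝ} {Ω : Set ℂ} (hu : ContDiffOn ℝ 2 u Ω) (i : Fin 2) :
    ContDiffOn ℝ 2 (coord u i) Ω := contDiffOn_pi.1 hu i

theorem contDiffOn_jacNorm_rpow {u : ℂ → Fin 2 → ℝ} {U : Set ℂ} (hU : IsOpen U)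
    (hu : ContDiffOn ℝ 2 u U) (hJ : ∀ z ∈ U, jacNorm u z ≠ 0) (s : ℝ) :
    ContDiffOn ℝ 1 (fun z => jacNorm u z ^ s) U := by
  have h00 := contDiffOn_dx hU (contDiffOn_coord hu 0)
  have h01 := contDiffOn_dy hU (contDiffOn_coord hu 0)
  have h10 := contDiffOn_dx hU (contDiffOn_coord hu 1)
  have h11 := contDiffOn_dy hU (contDiffOn_coord hu 1)
  refine ContDiffOn.rpow_const_of_ne ?_ hJ
  simp only [funext (jacNorm_eq u)]
  refine ContDiffOn.sqrt (((h00.pow 2).add (h01.pow 2)).add ((h10.pow 2).add (h11.pow 2)))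
    fun z hz h => hJ z hz ?_
  rw [jacNorm_eq]
  exact Real.sqrt_eq_zero'.2 h.le

/-- The directional derivative of `|Du|²/2`. -/
noncomputable def energyDeriv (u : ℂ → Fin 2 → ℝ) (e z : ℂ) : ℝ :=
  dx (coord u 0) z * fderiv ℝ (dx (coord u 0)) z e +
    dy (coord u 0) z * fderiv ℝ (dy (coord u 0)) z e +
  (dx (coord u 1) z * fderiv ℝ (dx (coord u 1)) z e +
    dy (coord u 1) z * fderiv ℝ (dy (coord u 1)) z e)

/-- The product rule, with `|Du|^(s-2)` factored out so that this positive factor can be cancelled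
from the equation. -/
theorem fderiv_jacNorm_rpow_mul {u : ℂ → Fin 2 → ℝ} {U : Set ℂ} (hU : IsOpen U)
    (hu : ContDiffOn ℝ 2 u U) (hJ : ∀ z ∈ U, jacNorm u z ≠ 0) (s : ℝ) {A : ℂ → ℝ}
    (hA : ContDiffOn ℝ 1 A U) {z : ℂ} (hz : z ∈ U) (e : ℂ) :
    fderiv ℝ (fun z => jacNorm u z ^ s * A z) z e =
      jacNorm u z ^ (s - 2) * (s * energyDeriv u e z * A z + jacNorm u z ^ 2 * fderiv ℝ A z e) := by
  have hdiff : ∀ {F : ℂ → ℝ}, ContDiffOn ℝ 1 F U → HasLineDerivAt ℝ F (fderiv ℝ F z e) z e :=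
    fun hF => ((hF.contDiffAt (hU.mem_nhds hz)).differentiableAt
      (by norm_num)).hasLineDerivAt_fderiv e
  have hJz : 0 < jacNorm u z := (jacNorm_nonneg u z).lt_of_ne' (hJ z hz)
  have h1 := hdiff ((contDiffOn_jacNorm_rpow hU hu hJ s).mul hA)
  have h00 := hdiff (contDiffOn_dx hU (contDiffOn_coord hu 0))
  have h01 := hdiff (contDiffOn_dy hU (contDiffOn_coord hu 0))
  have h10 := hdiff (contDiffOn_dx hU (contDiffOn_coord hu 1))
  have h11 := hdiff (contDiffOn_dy hU (contDiffOn_coord hu 1))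
  have hA' := hdiff hA
  unfold HasLineDerivAt at *
  have hne : dx (coord u 0) z ^ 2 + dy (coord u 0) z ^ 2 +
      (dx (coord u 1) z ^ 2 + dy (coord u 1) z ^ 2) ≠ 0 := fun h =>
    hJ z hz (by rw [jacNorm_eq, h, Real.sqrt_zero])
  have h2 := h00.sqrt_four_squares h01 h10 h11 (by simpa using hne)
  simp only [← jacNorm_eq, zero_smul, add_zero] at h2
  have h3 := (h2.rpow_const (p := s) (Or.inl (by simpa using hJz.ne'))).mul hA'
  refine (h1.unique h3).trans ?_
  simp only [zero_smul, add_zero]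
  have e1 : jacNorm u z ^ s = jacNorm u z ^ (s - 2) * jacNorm u z ^ 2 := by
    rw [← Real.rpow_natCast, ← Real.rpow_add hJz]; norm_num
  have e2 : jacNorm u z ^ (s - 1) = jacNorm u z ^ (s - 2) * jacNorm u z := by
    nth_rewrite 3 [← Real.rpow_one (jacNorm u z)]
    rw [← Real.rpow_add hJz]; ring_nf
  rw [e1, e2, energyDeriv]
  field_simp

/-- The non-divergence form of the `p`-harmonic system where `Du` does not vanish. -/
theorem IsPHarmonicMap.ae_nondivergence {p : ℝ} {Ω U : Set ℂ} {u : ℂ → Fin 2 → ℝ}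
    (hpu : IsPHarmonicMap p Ω u) (hU : IsOpen U) (hUΩ : U ⊆ Ω) (hu : ContDiffOn ℝ 2 u U)
    (hJ : ∀ z ∈ U, jacNorm u z ≠ 0) (i : Fin 2) :
    ∀ᵐ z, z ∈ U → jacNorm u z ^ 2 * (dx (dx (coord u i)) z + dy (dy (coord u i)) z) +
      (p - 2) * (energyDeriv u 1 z * dx (coord u i) z +
        energyDeriv u Complex.I z * dy (coord u i) z) = 0 := by
  have hX := contDiffOn_dx hU (contDiffOn_coord hu i)
  have hY := contDiffOn_dy hU (contDiffOn_coord hu i)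
  set P : ℂ → ℝ := fun z => jacNorm u z ^ (p - 2) * dx (coord u i) z with hP
  set Q : ℂ → ℝ := fun z => jacNorm u z ^ (p - 2) * dy (coord u i) z with hQ
  have hPc : ContDiffOn ℝ 1 P U := (contDiffOn_jacNorm_rpow hU hu hJ _).mul hX
  have hQc : ContDiffOn ℝ 1 Q U := (contDiffOn_jacNorm_rpow hU hu hJ _).mul hY
  have hline : ∀ {F : ℂ → ℝ} (e : ℂ), ContDiffOn ℝ 1 F U →
      ∀ z ∈ U, HasLineDerivAt ℝ F (fderiv ℝ F z e) z e := fun e hF z hz =>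
    ((hF.contDiffAt (hU.mem_nhds hz)).differentiableAt (by norm_num)).hasLineDerivAt_fderiv e
  have hdc : ContinuousOn (fun z => fderiv ℝ P z 1 + fderiv ℝ Q z Complex.I) U :=
    (continuousOn_fderiv_apply hU hPc 1).add (continuousOn_fderiv_apply hU hQc Complex.I)
  -- Where `Du ≠ 0` the field is `C¹`, so the weak equation can be integrated by parts and the
  -- fundamental lemma of the calculus of variations applies.
  have hzero := hU.ae_eq_zero_of_integral_contDiff_smul_eq_zero
    (hdc.locallyIntegrableOn hU.measurableSet (μ := volume)) (fun φ hφ hφc hφU => by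
      have hφ1 : ContDiff ℝ 1 φ := hφ.of_le (by exact_mod_cast le_top)
      have h1 := integral_test_mul_div hφ1 hφc hφU (hline 1 hPc) (hline Complex.I hQc)
        hPc.continuousOn hQc.continuousOn (continuousOn_fderiv_apply hU hPc 1)
        (continuousOn_fderiv_apply hU hQc Complex.I)
      have h2 := hpu i φ ⟨hφ, hφc, hφU.trans hUΩ⟩
      rw [setIntegral_eq_integral_of_forall_compl_eq_zero (fun z hz => by
        simp [dx, dy, fderiv_eq_zero_of_notMem_tsupport fun h => hz (hUΩ (hφU h))])] at h2
      have h3 : ∫ z, (dx φ z * P z + dy φ z * Q z) = 0 := by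
        rw [← h2]
        exact integral_congr_ae (ae_of_all _ fun z => by simp only [hP, hQ]; ring)
      simp only [smul_eq_mul]
      linarith)
  filter_upwards [hzero] with z hz hzU
  have h := hz hzU
  rw [fderiv_jacNorm_rpow_mul hU hu hJ _ hX hzU, fderiv_jacNorm_rpow_mul hU hu hJ _ hY hzU,
    ← mul_add] at h
  have hJz : 0 < jacNorm u z := (jacNorm_nonneg u z).lt_of_ne' (hJ z hzU)
  have := (mul_eq_zero.1 h).resolve_left (Real.rpow_pos_of_pos hJz _).ne'
  simp only [dx, dy] at this ⊢
  linarith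

theorem norm_complexGrad (v : ℂ → ℝ) (z : ℂ) : ‖complexGrad v z‖ = gradNorm v z / 2 := by
  have h : ‖complexGrad v z‖ ^ 2 = (gradNorm v z / 2) ^ 2 := by
    rw [div_pow, gradNorm_sq, ← Complex.normSq_eq_norm_sq, complexGrad, map_mul]
    simp [Complex.normSq_apply]
    ring
  exact (sq_eq_sq₀ (norm_nonneg _) (div_nonneg (gradNorm_nonneg v z) zero_le_two)).1 h

theorem fderiv_complexGrad {v : ℂ → ℝ} {z : ℂ} (hx : DifferentiableAt ℝ (dx v) z)
    (hy : DifferentiableAt ℝ (dy v) z) (e : ℂ) :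
    fderiv ℝ (complexGrad v) z e =
      (1 / 2 : ℂ) * ((fderiv ℝ (dx v) z e : ℂ) - Complex.I * (fderiv ℝ (dy v) z e : ℂ)) := by
  have h1 : HasFDerivAt (fun w => (dx v w : ℂ)) (Complex.ofRealCLM.comp (fderiv ℝ (dx v) z)) z :=
    Complex.ofRealCLM.hasFDerivAt.comp z hx.hasFDerivAt
  have h2 : HasFDerivAt (fun w => (dy v w : ℂ)) (Complex.ofRealCLM.comp (fderiv ℝ (dy v) z)) z :=
    Complex.ofRealCLM.hasFDerivAt.comp z hy.hasFDerivAt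
  have h3 := (h1.sub (h2.const_mul Complex.I)).const_mul (1 / 2 : ℂ)
  have h4 : HasFDerivAt (complexGrad v) _ z := h3
  rw [h4.fderiv]
  simp

/-- The `z`-derivative of the complex gradient is `(v_xx - v_yy) / 4 - i v_xy / 2`: it is the
trace-free part of the Hessian. -/
theorem norm_sq_wirtingerZ_complexGrad {v : ℂ → ℝ} {Ω : Set ℂ} (hΩ : IsOpen Ω)
    (hv : ContDiffOn ℝ 2 v Ω) {z : ℂ} (hz : z ∈ Ω) :
    ‖wirtingerZ (complexGrad v) z‖ ^ 2 =
      (((dx (dx v) z - dy (dy v) z) / 2) ^ 2 + dy (dx v) z ^ 2) / 4 := by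
  have hx : DifferentiableAt ℝ (dx v) z :=
    ((contDiffOn_dx hΩ hv).contDiffAt (hΩ.mem_nhds hz)).differentiableAt (by norm_num)
  have hy : DifferentiableAt ℝ (dy v) z :=
    ((contDiffOn_dy hΩ hv).contDiffAt (hΩ.mem_nhds hz)).differentiableAt (by norm_num)
  have hs := dx_dy_eq_dy_dx hΩ hv hz
  rw [wirtingerZ, fderiv_complexGrad hx hy, fderiv_complexGrad hx hy]
  simp only [dx, dy] at hs ⊢
  rw [hs, ← Complex.normSq_eq_norm_sq, map_mul]
  simp [Complex.normSq_apply]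
  ring

theorem jacNorm_sq (u : ℂ → Fin 2 → ℝ) (z : ℂ) : jacNorm u z ^ 2 =
    dx (coord u 0) z ^ 2 + dy (coord u 0) z ^ 2 + dx (coord u 1) z ^ 2 +
      dy (coord u 1) z ^ 2 := by
  rw [jacNorm_eq, Real.sq_sqrt (by positivity)]; ring

/-- For a `p`-harmonic map the Hessian is controlled by the `z`-derivatives of the complex
gradients where `Du` does not vanish. -/
theorem IsPHarmonicMap.ae_hessNorm_le {p : ℝ} (hp : 1 < p) {Ω U : Set ℂ} {u : ℂ → Fin 2 → ℝ}
    (hpu : IsPHarmonicMap p Ω u) (hU : IsOpen U) (hUΩ : U ⊆ Ω) (hu : ContDiffOn ℝ 2 u U)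
    (hJ : ∀ z ∈ U, jacNorm u z ≠ 0) (i : Fin 2) :
    ∀ᵐ z, z ∈ U → hessNorm (coord u i) z ≤ Real.sqrt (8 + 8 * (p - 2) ^ 2) *
      (‖wirtingerZ (complexGrad (coord u 0)) z‖ + ‖wirtingerZ (complexGrad (coord u 1)) z‖) := by
  filter_upwards [hpu.ae_nondivergence hU hUΩ hu hJ 0, hpu.ae_nondivergence hU hUΩ hu hJ 1]
    with z h0 h1 hz
  have hJz : 0 < jacNorm u z ^ 2 := by have := hJ z hz; positivity
  have s0 := dx_dy_eq_dy_dx hU (contDiffOn_coord hu 0) hz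
  have s1 := dx_dy_eq_dy_dx hU (contDiffOn_coord hu 1) hz
  have w0 := norm_sq_wirtingerZ_complexGrad hU (contDiffOn_coord hu 0) hz
  have w1 := norm_sq_wirtingerZ_complexGrad hU (contDiffOn_coord hu 1) hz
  have k0 := h0 hz
  have k1 := h1 hz
  rw [jacNorm_sq] at hJz k0 k1
  have key := laplacian_sq_le hp hJz
    (D₀ := dx (dx (coord u 0)) z + dy (dy (coord u 0)) z)
    (D₁ := dx (dx (coord u 1)) z + dy (dy (coord u 1)) z)
    (β₀ := (dx (dx (coord u 0)) z - dy (dy (coord u 0)) z) / 2)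
    (β₁ := (dx (dx (coord u 1)) z - dy (dy (coord u 1)) z) / 2)
    (q₀ := dy (dx (coord u 0)) z) (q₁ := dy (dx (coord u 1)) z)
    (Nx := energyDeriv u 1 z) (Ny := energyDeriv u Complex.I z)
    (by
      simp only [energyDeriv, dx, dy] at s0 s1 ⊢
      rw [s0, s1]; ring)
    (by simp only [energyDeriv, dx, dy]; ring) k0 k1
  set W0 := ‖wirtingerZ (complexGrad (coord u 0)) z‖ with hW0
  set W1 := ‖wirtingerZ (complexGrad (coord u 1)) z‖ with hW1
  have hW0n : 0 ≤ W0 := norm_nonneg _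
  have hW1n : 0 ≤ W1 := norm_nonneg _
  rw [mul_pow, sq_abs] at key
  -- The squared Hessian norm is 8 times the squared `z`-derivative plus half the squared Laplacian,
  -- and the squared Laplacians sum to at most `4 (p - 2)² · 4 (W0² + W1²)`.
  have hi : hessNorm (coord u i) z ^ 2 ≤ (8 + 8 * (p - 2) ^ 2) * (W0 ^ 2 + W1 ^ 2) := by
    have hE : ((dx (dx (coord u 0)) z - dy (dy (coord u 0)) z) / 2) ^ 2 + dy (dx (coord u 0)) z ^ 2 +
        ((dx (dx (coord u 1)) z - dy (dy (coord u 1)) z) / 2) ^ 2 + dy (dx (coord u 1)) z ^ 2 =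
        4 * (W0 ^ 2 + W1 ^ 2) := by rw [w0, w1]; ring
    rw [hE] at key
    fin_cases i
    · change hessNorm (coord u 0) z ^ 2 ≤ _
      rw [hessNorm_sq, s0]
      have : dx (dx (coord u 0)) z ^ 2 + dy (dx (coord u 0)) z ^ 2 + dy (dx (coord u 0)) z ^ 2 +
          dy (dy (coord u 0)) z ^ 2 = 8 * W0 ^ 2 +
          (dx (dx (coord u 0)) z + dy (dy (coord u 0)) z) ^ 2 / 2 := by rw [w0]; ring
      rw [this]
      linarith [sq_nonneg W1, sq_nonneg (dx (dx (coord u 1)) z + dy (dy (coord u 1)) z)]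
    · change hessNorm (coord u 1) z ^ 2 ≤ _
      rw [hessNorm_sq, s1]
      have : dx (dx (coord u 1)) z ^ 2 + dy (dx (coord u 1)) z ^ 2 + dy (dx (coord u 1)) z ^ 2 +
          dy (dy (coord u 1)) z ^ 2 = 8 * W1 ^ 2 +
          (dx (dx (coord u 1)) z + dy (dy (coord u 1)) z) ^ 2 / 2 := by rw [w1]; ring
      rw [this]
      linarith [sq_nonneg W0, sq_nonneg (dx (dx (coord u 0)) z + dy (dy (coord u 0)) z)]
  refine le_of_sq_le_sq ?_ (by positivity)
  rw [mul_pow, Real.sq_sqrt (by positivity)]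
  refine hi.trans ?_
  gcongr
  nlinarith [mul_nonneg hW0n hW1n]

theorem gradNorm_le_jacNorm (u : ℂ → Fin 2 → ℝ) (i : Fin 2) (z : ℂ) :
    gradNorm (coord u i) z ≤ jacNorm u z := by
  apply Real.le_sqrt_of_sq_le
  fin_cases i
  · exact le_add_of_nonneg_right (sq_nonneg _)
  · exact le_add_of_nonneg_left (sq_nonneg _)

/-! ### Integrability of the Hessian over the gradient. -/

theorem aestronglyMeasurable_hessNorm_div {v : ℂ → ℝ} {Ω B : Set ℂ} (hΩ : IsOpen Ω)
    (hv : ContDiffOn ℝ 2 v Ω) (hB : B ⊆ Ω) (hBm : MeasurableSet B) :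
    AEStronglyMeasurable (fun z => hessNorm v z / gradNorm v z) (volume.restrict B) :=
  ((((continuousOn_hessNorm hΩ hv).mono hB).aemeasurable hBm).div
    (((continuousOn_gradNorm hΩ (hv.of_le one_le_two)).mono hB).aemeasurable
      hBm)).aestronglyMeasurable

theorem integrableOn_levelCurvature {v : ℂ → ℝ} {Ω B : Set ℂ} (hΩ : IsOpen Ω)
    (hv : ContDiffOn ℝ 2 v Ω) (hB : B ⊆ Ω) (hBm : MeasurableSet B)
    (hint : IntegrableOn (fun z => hessNorm v z / gradNorm v z) B) :
    IntegrableOn (levelCurvature v) B := by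
  refine Integrable.mono' hint ?_ ?_
  · have h1 := continuousOn_dx hΩ (hv.of_le one_le_two)
    have h2 := continuousOn_dy hΩ (hv.of_le one_le_two)
    have h3 := continuousOn_dx hΩ (contDiffOn_dx hΩ hv)
    have h4 := continuousOn_dy hΩ (contDiffOn_dx hΩ hv)
    have h5 := continuousOn_dy hΩ (contDiffOn_dy hΩ hv)
    have hn : ContinuousOn (fun z => dy v z ^ 2 * dx (dx v) z - 2 * dx v z * dy v z * dy (dx v) z
      + dx v z ^ 2 * dy (dy v) z) Ω := by fun_prop
    exact (((hn.mono hB).aemeasurable hBm).div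
      ((((continuousOn_gradNorm hΩ (hv.of_le one_le_two)).pow 3).mono hB).aemeasurable
        hBm)).neg.aestronglyMeasurable
  · filter_upwards [ae_restrict_mem hBm] with z hz
    exact abs_levelCurvature_le (dx_dy_eq_dy_dx hΩ hv (hB hz))

theorem integrableOn_hessNorm_div_of_lt {v : ℂ → ℝ} {Ω B : Set ℂ} (hΩ : IsOpen Ω)
    (hv : ContDiffOn ℝ 2 v Ω) (hB : B ⊆ Ω) (hBm : MeasurableSet B)
    (hH : IntegrableOn (hessNorm v) B) {C : ℝ} (hC : 0 < C)
    (hg : ∀ z ∈ B, C < ‖complexGrad v z‖) :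
    IntegrableOn (fun z => hessNorm v z / gradNorm v z) B := by
  refine Integrable.mono' (hH.const_mul (1 / C))
    (aestronglyMeasurable_hessNorm_div hΩ hv hB hBm) ?_
  filter_upwards [ae_restrict_mem hBm] with z hz
  have h1 := hg z hz
  rw [norm_complexGrad] at h1
  rw [Real.norm_of_nonneg (div_nonneg (hessNorm_nonneg v z) (gradNorm_nonneg v z)),
    one_div_mul_eq_div]
  exact div_le_div_of_nonneg_left (hessNorm_nonneg v z) hC (by linarith)

theorem integrableOn_norm_sub_rpow_ball (z₀ : ℂ) {R s : ℝ} (hR : 0 < R) (hs : -2 < s) :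
    IntegrableOn (fun z : ℂ => ‖z - z₀‖ ^ s) (Metric.ball z₀ R) := by
  have h0 : IntegrableOn (fun z : ℂ => ‖z‖ ^ s) (Metric.ball 0 R) := by
    rw [integrableOn_fun_norm_addHaar volume (f := fun y : ℝ => y ^ s)]
    refine ((intervalIntegral.integrableOn_Ioo_rpow_iff hR).2
      (show -1 < s + 1 by linarith)).congr_fun (fun y hy => ?_) measurableSet_Ioo
    simp only [Complex.finrank_real_complex, smul_eq_mul]
    rw [Real.rpow_add hy.1, Real.rpow_one]
    simp [mul_comm]
  have h1 := (measurePreserving_sub_right (volume : Measure ℂ) z₀).integrableOn_comp_preimage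
    (MeasurableEquiv.subRight z₀).measurableEmbedding (f := fun z : ℂ => ‖z‖ ^ s)
    (s := Metric.ball 0 R)
  have h2 : (fun z => z - z₀) ⁻¹' Metric.ball 0 R = Metric.ball z₀ R := by
    ext z; simp [dist_eq_norm]
  rw [h2] at h1
  exact h1.2 h0

/-- The Hessian is bounded on the compact closed ball, so the quotient is at most a constant times
`|z - z₀|^{-α}`; `α < 2` is the integrability threshold in the plane. -/
theorem integrableOn_hessNorm_div_of_rpow_lt {v : ℂ → ℝ} {Ω : Set ℂ} (hΩ : IsOpen Ω)
    (hv : ContDiffOn ℝ 2 v Ω) {z₀ : ℂ} {R : ℝ} (hR : 0 < R) (hB : Metric.closedBall z₀ R ⊆ Ω)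
    {C α : ℝ} (hC : 0 < C) (hα : α < 2)
    (hg : ∀ z ∈ Metric.ball z₀ R, z ≠ z₀ → C * ‖z - z₀‖ ^ α < ‖complexGrad v z‖) :
    IntegrableOn (fun z => hessNorm v z / gradNorm v z) (Metric.ball z₀ R) := by
  have hBo := Metric.ball_subset_closedBall.trans hB
  obtain ⟨M, hM⟩ := (isCompact_closedBall z₀ R).exists_bound_of_continuousOn
    ((continuousOn_hessNorm hΩ hv).mono hB)
  refine Integrable.mono' ((integrableOn_norm_sub_rpow_ball z₀ hR
    (show -2 < -α by linarith)).const_mul (M / C))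
    (aestronglyMeasurable_hessNorm_div hΩ hv hBo measurableSet_ball) ?_
  filter_upwards [ae_restrict_mem measurableSet_ball,
    ae_restrict_of_ae (Measure.ae_ne volume z₀)] with z hz hne
  have h1 := hg z hz hne
  have hp : 0 < ‖z - z₀‖ := norm_pos_iff.2 (sub_ne_zero.2 hne)
  have hpα := Real.rpow_pos_of_pos hp α
  rw [norm_complexGrad] at h1
  have hHM := (le_abs_self _).trans (hM z (Metric.ball_subset_closedBall hz))
  rw [Real.norm_of_nonneg (div_nonneg (hessNorm_nonneg v z) (gradNorm_nonneg v z)),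
    Real.rpow_neg hp.le, ← div_eq_mul_inv, div_div]
  have : 0 < C * ‖z - z₀‖ ^ α := by positivity
  exact div_le_div₀ ((hessNorm_nonneg v z).trans hHM) hHM this (by linarith)

theorem theorem3 (p : ℝ) (hp : 1 < p) (hp2 : p ≠ 2)
    (Ω : Set ℂ) (hΩ : IsOpen Ω) (hΩc : IsConnected Ω)
    (u : ℂ → Fin 2 → ℝ) (hu : ContDiffOn ℝ 2 u Ω) (hpu : IsPHarmonicMap p Ω u)
    (C : ℝ) (hC : 0 < C) (z₀ : ℂ) (R : ℝ) (hR : 0 < R) (hB : Metric.ball z₀ R ⊆ Ω)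
    (i : Fin 2)
    (h :
      -- (1)
      ((∀ j : Fin 2, MemLp (hessNorm (coord u j)) 2 (volume.restrict (Metric.ball z₀ R))) ∧
        ∀ z ∈ Metric.ball z₀ R, C < ‖complexGrad (coord u i) z‖) ∨
      -- (2)
      ((∀ j : Fin 2, MemLp (wirtingerZ (complexGrad (coord u j))) 2
          (volume.restrict (Metric.ball z₀ R))) ∧
        ∀ z ∈ Metric.ball z₀ R, C < ‖complexGrad (coord u i) z‖) ∨
      -- (3)
      (Metric.closedBall z₀ R ⊆ Ω ∧
        (∀ j : Fin 2, QuasiregularOn (complexGrad (coord u j)) (Metric.ball z₀ R)) ∧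
        ∀ z ∈ Metric.ball z₀ R, C < ‖complexGrad (coord u i) z‖) ∨
      -- (4)
      (Metric.closedBall z₀ R ⊆ Ω ∧
        (∀ j : Fin 2, QuasiregularOn (complexGrad (coord u j)) (Metric.ball z₀ R)) ∧
        ∃ α : ℝ, α < 1 ∧ ∀ z ∈ Metric.ball z₀ R, z ≠ z₀ →
          C * ‖z - z₀‖ ^ α < ‖complexGrad (coord u i) z‖)) :
    IntegrableOn (levelCurvature (coord u i)) (Metric.ball z₀ R) ∧
    ((∀ z ∈ criticalSet (coord u i) Ω, ∀ᶠ w in 𝓝[≠] z, w ∉ criticalSet (coord u i) Ω) →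
      ∀ c : ℝ, ({z ∈ Ω | coord u i z = c} ∩ Metric.ball z₀ R).Nonempty →
        Disjoint (criticalSet (coord u i) Ω)
          ({z ∈ Ω | coord u i z = c} ∩ Metric.ball z₀ R) →
        Measure.hausdorffMeasure 1 ({z ∈ Ω | coord u i z = c} ∩ Metric.ball z₀ R) ≤
          ENNReal.ofReal ((∫ z in Ω ∩ Metric.ball z₀ R, |levelCurvature (coord u i) z|)
            + 2 * Real.pi * R)) := by
  have hv : ContDiffOn ℝ 2 (coord u i) Ω := contDiffOn_coord hu i
  have hne_of_lt : (∀ z ∈ Metric.ball z₀ R, C < ‖complexGrad (coord u i) z‖) →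
      ∀ z ∈ Metric.ball z₀ R, gradNorm (coord u i) z ≠ 0 := by
    intro hg z hz h0
    have := hg z hz
    rw [norm_complexGrad, h0] at this
    linarith
  have : IsFiniteMeasure (volume.restrict (Metric.ball z₀ R)) :=
    isFiniteMeasure_restrict.2 measure_ball_lt_top.ne
  have main : IntegrableOn (fun z => hessNorm (coord u i) z / gradNorm (coord u i) z)
      (Metric.ball z₀ R) ∧
      ∀ᵐ z ∂volume.restrict (Metric.ball z₀ R), gradNorm (coord u i) z ≠ 0 := by
    rcases h with ⟨hH, hg⟩ | ⟨hW, hg⟩ | ⟨hcl, -, hg⟩ | ⟨hcl, -, α, hα, hg⟩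
    · refine ⟨integrableOn_hessNorm_div_of_lt hΩ hv hB measurableSet_ball
        ((hH i).integrable one_le_two) hC hg, ?_⟩
      filter_upwards [ae_restrict_mem measurableSet_ball] with z hz using hne_of_lt hg z hz
    -- A lower bound for one gradient already keeps `Du` away from zero, so the non-divergence form
    -- of the system holds a.e. in the ball.
    · have hJ : ∀ z ∈ Metric.ball z₀ R, jacNorm u z ≠ 0 := fun z hz h0 =>
        hne_of_lt hg z hz (le_antisymm ((gradNorm_le_jacNorm u i z).trans h0.le)
          (gradNorm_nonneg _ z))
      have hae := (ae_restrict_iff' measurableSet_ball).2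
        (hpu.ae_hessNorm_le hp Metric.isOpen_ball hB (hu.mono hB) hJ i)
      have hHi : IntegrableOn (hessNorm (coord u i)) (Metric.ball z₀ R) := by
        refine Integrable.mono' ((((hW 0).integrable one_le_two).norm.add
          ((hW 1).integrable one_le_two).norm).const_mul (Real.sqrt (8 + 8 * (p - 2) ^ 2)))
          (((continuousOn_hessNorm hΩ hv).mono hB).aestronglyMeasurable measurableSet_ball) ?_
        filter_upwards [hae] with z hz
        rw [Real.norm_of_nonneg (hessNorm_nonneg _ z)]
        exact hz
      refine ⟨integrableOn_hessNorm_div_of_lt hΩ hv hB measurableSet_ball hHi hC hg, ?_⟩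
      filter_upwards [ae_restrict_mem measurableSet_ball] with z hz using hne_of_lt hg z hz
    · have hHi : IntegrableOn (hessNorm (coord u i)) (Metric.ball z₀ R) :=
        (((continuousOn_hessNorm hΩ hv).mono hcl).integrableOn_compact
          (isCompact_closedBall z₀ R)).mono_set Metric.ball_subset_closedBall
      refine ⟨integrableOn_hessNorm_div_of_lt hΩ hv hB measurableSet_ball hHi hC hg, ?_⟩
      filter_upwards [ae_restrict_mem measurableSet_ball] with z hz using hne_of_lt hg z hz
    · refine ⟨integrableOn_hessNorm_div_of_rpow_lt hΩ hv hR hcl hC (by linarith) hg, ?_⟩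
      filter_upwards [ae_restrict_mem measurableSet_ball,
        ae_restrict_of_ae (Measure.ae_ne volume z₀)] with z hz hne h0
      have h1 := hg z hz hne
      have := Real.rpow_pos_of_pos (norm_pos_iff.2 (sub_ne_zero.2 hne)) α
      rw [norm_complexGrad, h0] at h1
      nlinarith
  refine ⟨integrableOn_levelCurvature hΩ hv hB measurableSet_ball main.1, ?_⟩
  intro _ c _ hdisj
  have hset : {z ∈ Ω | coord u i z = c} ∩ Metric.ball z₀ R =
      Metric.ball z₀ R ∩ {z | coord u i z = c} := by
    ext z
    constructor
    · rintro ⟨⟨-, hz⟩, hzB⟩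
      exact ⟨hzB, hz⟩
    · rintro ⟨hzB, hz⟩
      exact ⟨⟨hB hzB, hz⟩, hzB⟩
  rw [inter_eq_self_of_subset_right hB, hset]
  refine hausdorffMeasure_levelSet_le hΩ hv hB main.1 main.2 fun z hz hzc h0 => ?_
  have hsq := gradNorm_sq (coord u i) z
  rw [h0] at hsq
  -- A zero of `gradNorm` on the level would be a critical point there, against disjointness.
  have hcrit : z ∈ criticalSet (coord u i) Ω :=
    ⟨hB hz, by nlinarith [sq_nonneg (dy (coord u i) z)], by nlinarith [sq_nonneg (dx (coord u i) z)]⟩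
  exact Set.disjoint_left.1 hdisj hcrit ⟨⟨hB hz, hzc⟩, hz⟩
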